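/- Let $\mathcal F$ be an ordinary differential field of characteristic $0$ with derivation $\delta$, let $\mathcal E$ be a differential field extension of $\mathcal F$, and let $u\in\mathcal E$ be differentially transcendental over $\mathcal F$ (that is, $u,u',u'',\dots$ are algebraically independent over $\mathcal F$). Let $A\in\mathcal F\{x,y\}$ be an irreducible differential polynomial, with saturation ideal $\mathrm{sat}(A)=[A]:H_A^\infty$, where $[A]$ is the differential ideal generated by $A$ and $H_A$ is the product of the initial and the separant of $A$ under a given ranking of the derivatives of $x,y$; let $(\mathcal C,A)$ be the differential curve $\mathcal C=\mathbb V(\mathrm{sat}(A))$. Let $P_1,Q_1,P_2,Q_2\in\mathcal F\{u\}$ have total degree at most $1$ in $u,u',u'',\dots$, with $Q_i\neq0$ and $\gcd(P_i,Q_i)=1$ for $i=1,2$. Suppose that $\mathcal P(u)=\big(\tfrac{P_1(u)}{Q_1(u)},\tfrac{P_2(u)}{Q_2(u)}\big)$ is a differential rational parametrization of $(\mathcal C,A)$, that is, a generic point: $\{f\in\mathcal F\{x,y\}: f(\mathcal P(u))=0\}=\mathrm{sat}(A)$. Suppose that $\mathcal P(u)$ is proper, that is, $\mathcal F\langle \tfrac{P_1(u)}{Q_1(u)},\tfrac{P_2(u)}{Q_2(u)}\rangle=\mathcal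 F\langle u\rangle$, where $\mathcal F\langle S\rangle$ is the differential field generated by $S$ over $\mathcal F$. For $i=1,2$ suppose that $m_i:=\max\{\mathrm{ord}\,P_i,\mathrm{ord}\,Q_i\}\ge0$, where the order of a differential polynomial is the largest $k$ such that a $k$-th derivative of an indeterminate appears in it, and is $-\infty$ for constants. For linear differential polynomials $f_1,f_2$ in $u$ of orders $n_1,n_2$ over a differential domain, let $\delta\text{-}\mathrm{Res}(f_1,f_2)$ be the determinant of the square matrix of size $n_1+n_2+2$ whose rows are the coefficient vectors of $f_1^{(n_2)},\dots,f_1',f_1,f_2^{(n_1)},\dots,f_2',f_2$ with respect to $u^{(n_1+n_2)},\dots,u',u,1$. Then $A$ is the main irreducible factor of $$R=\delta\text{-}\mathrm{Res}\big(xQ_1(u)-P_1(u),\;yQ_2(u)-P_2(u)\big)\in\mathcal F\{x,y\},$$ that is, $A$ is irreducible and divides $R$, and if $R=AB$ then $\mathrm{ord}(B)<\mathrm{ord}(R)$. In particular, $\deg_{x^{(m_2)}}A=1$ and $\deg_{y^{(m_1)}}A=1$. -/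

import Mathlib

open MvPolynomial

noncomputable section

namespace DiffAlg

/-- The ring `R{y_i : i ∈ σ}` of differential polynomials as a polynomial ring:
the variable `(i, k)` is the derivative `y_i^{(k)}`. -/
abbrev DiffPoly (σ : Type*) (R : Type*) [CommRing R] := MvPolynomial (σ × ℕ) R

/-- The `k`-th derivative `a^{(k)}` in a differential ring. -/
def iterDeriv {R : Type*} [CommRing R] [Differential R] (k : ℕ) (a : R) : R :=
  (Differential.deriv : Derivation ℤ R R)^[k] a

section Derivation

variable {σ R : Type*} [CommRing R] [Differential R]

/-- Apply the derivation of `R` to the coefficients of a polynomial. -/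
def coeffDeriv {τ : Type*} (f : MvPolynomial τ R) : MvPolynomial τ R :=
  ∑ m ∈ f.support, monomial m (Differential.deriv (coeff m f))

lemma coeff_coeffDeriv {τ : Type*} (f : MvPolynomial τ R) (m : τ →₀ ℕ) :
    coeff m (coeffDeriv f) = Differential.deriv (coeff m f) := by
  classical
  unfold coeffDeriv
  rw [coeff_sum]
  simp only [coeff_monomial, Finset.sum_ite_eq', mem_support_iff]
  split_ifs with h
  · rfl
  · rw [not_not] at h
    rw [h, map_zero]

lemma coeffDeriv_add {τ : Type*} (f g : MvPolynomial τ R) :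
    coeffDeriv (f + g) = coeffDeriv f + coeffDeriv g := by
  ext m
  simp [coeff_coeffDeriv]

lemma coeffDeriv_mul {τ : Type*} (f g : MvPolynomial τ R) :
    coeffDeriv (f * g) = f * coeffDeriv g + g * coeffDeriv f := by
  classical
  ext m
  rw [mul_comm g]
  simp only [coeff_coeffDeriv, coeff_add, coeff_mul, map_sum, Derivation.leibniz, smul_eq_mul,
    ← Finset.sum_add_distrib]
  refine Finset.sum_congr rfl fun p _ => ?_
  ring

/-- The derivation of `R{y_i : i ∈ σ}`: it extends that of `R` and maps `y_i^{(k)}` to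
`y_i^{(k+1)}`. -/
instance : Differential (DiffPoly σ R) where
  deriv := Derivation.mk'
    (AddMonoidHom.toIntLinearMap
      (AddMonoidHom.mk' (fun f : DiffPoly σ R =>
          coeffDeriv f + mkDerivation R (fun v : σ × ℕ => (X (v.1, v.2 + 1) : DiffPoly σ R)) f)
        (fun f g => by rw [coeffDeriv_add, map_add]; ring)))
    (fun f g => by
      simp only [AddMonoidHom.coe_toIntLinearMap, AddMonoidHom.mk'_apply, coeffDeriv_mul,
        Derivation.leibniz, smul_eq_mul]
      ring)

lemma deriv_def (f : DiffPoly σ R) :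
    Differential.deriv f = coeffDeriv f +
      mkDerivation R (fun v : σ × ℕ => (X (v.1, v.2 + 1) : DiffPoly σ R)) f := rfl

lemma deriv_X (i : σ) (k : ℕ) :
    Differential.deriv (X (i, k) : DiffPoly σ R) = X (i, k + 1) := by
  classical
  have h : coeffDeriv (X (i, k) : DiffPoly σ R) = 0 := by
    ext m
    rw [coeff_coeffDeriv, coeff_X]
    split_ifs <;> simp
  rw [deriv_def, h, mkDerivation_X, zero_add]

lemma deriv_C (a : R) :
    Differential.deriv (C a : DiffPoly σ R) = C (Differential.deriv a) := by
  classical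
  have h : coeffDeriv (C a : DiffPoly σ R) = C (Differential.deriv a) := by
    ext m
    rw [coeff_coeffDeriv, coeff_C, coeff_C]
    split_ifs <;> simp
  rw [deriv_def, h, derivation_C, add_zero]

end Derivation

section Order

variable {σ R : Type*} [CommRing R]

/-- The order of a differential polynomial: the largest `k` such that some `y_i^{(k)}` appears in
it, and `⊥` (that is, `-∞`) if it is a constant. -/
def ord (f : DiffPoly σ R) : WithBot ℕ := f.vars.sup fun v => (v.2 : WithBot ℕ)

end Order

section Extension

variable (F : Type*) {E : Type*} [Field F] [Field E] [Differential E] [Algebra F E]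

/-- `u` is differentially transcendental over `F`. -/
def DiffTranscendental (u : E) : Prop :=
  AlgebraicIndependent F fun k : ℕ => iterDeriv k u

/-- `F⟨S⟩`, the field generated over `F` by all derivatives of the elements of `S`. -/
def diffAdjoin (S : Set E) : IntermediateField F E :=
  IntermediateField.adjoin F {a | ∃ s ∈ S, ∃ k : ℕ, a = iterDeriv k s}

variable {F} {σ : Type*}

/-- The value `f(η)` of a differential polynomial at a point with coordinates in `E`. -/
def diffEval (η : σ → E) : DiffPoly σ F →ₐ[F] E :=
  aeval fun v : σ × ℕ => iterDeriv v.2 (η v.1)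

/-- `𝕀(η)`, the ideal of the differential polynomials over `F` that vanish at `η`. -/
def vanishingIdeal (η : σ → E) : Ideal (DiffPoly σ F) :=
  RingHom.ker (diffEval η : DiffPoly σ F →ₐ[F] E)

/-- `η` is a generic point of the differential ideal `S` (and of the variety `𝕍(S)`). -/
def IsGenericPoint (η : σ → E) (S : Set (DiffPoly σ F)) : Prop :=
  ((vanishingIdeal η : Ideal (DiffPoly σ F)) : Set (DiffPoly σ F)) = S

end Extension

/-- A ranking: a total order on the derivatives `y_i^{(k)}`, compatible with the derivation. -/
structure Ranking (σ : Type*) where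
  lt : σ × ℕ → σ × ℕ → Prop
  isStrictTotalOrder : IsStrictTotalOrder (σ × ℕ) lt
  lt_deriv : ∀ v : σ × ℕ, lt v (v.1, v.2 + 1)
  deriv_lt_deriv : ∀ v w : σ × ℕ, lt v w → lt (v.1, v.2 + 1) (w.1, w.2 + 1)

section Saturation

variable {σ R : Type*} [CommRing R]

/-- `v` is the leader of `f`: the highest ranked derivative that appears in `f`. -/
def IsLeader (r : Ranking σ) (f : DiffPoly σ R) (v : σ × ℕ) : Prop :=
  v ∈ f.vars ∧ ∀ w ∈ f.vars, w ≠ v → r.lt w v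

/-- The leading coefficient of `f` as a polynomial in the variable `v`; it is the initial of `f` if
`v` is the leader. -/
def initialAt (f : DiffPoly σ R) (v : σ × ℕ) : DiffPoly σ R :=
  ∑ m ∈ f.support with m v = f.degreeOf v, monomial (m.erase v) (coeff m f)

/-- `∂f/∂v`; it is the separant of `f` if `v` is the leader. -/
def separantAt (f : DiffPoly σ R) (v : σ × ℕ) : DiffPoly σ R := pderiv v f

variable [Differential R]

/-- `[S]`, the differential ideal generated by `S`. -/
def diffIdeal (S : Set (DiffPoly σ R)) : Ideal (DiffPoly σ R) :=
  Ideal.span {g | ∃ f ∈ S, ∃ k : ℕ, g = iterDeriv k f}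

/-- The saturation ideal `sat(A) = [A] : H_A^∞`, where `H_A` is the product of the initial and the
separant of the nonconstant `A` under the ranking `r`. -/
def sat (r : Ranking σ) (A : DiffPoly σ R) : Set (DiffPoly σ R) :=
  {f | ∃ v, IsLeader r A v ∧
    ∃ m : ℕ, (separantAt A v * initialAt A v) ^ m * f ∈ diffIdeal {A}}

end Saturation

section Parametrization

variable {F E : Type*} [Field F] [Differential F] [Field E] [Differential E] [Algebra F E]

/-- The point `(P₁(u)/Q₁(u), P₂(u)/Q₂(u))`. -/
def paramPoint (u : E) (P Q : Fin 2 → DiffPoly Unit F) : Fin 2 → E :=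
  fun i => diffEval (fun _ => u) (P i) / diffEval (fun _ => u) (Q i)

/-- The order of the fraction `P/Q`, which is meant to be in reduced form. -/
def ordFrac (P Q : DiffPoly Unit F) : WithBot ℕ := max (ord P) (ord Q)

/-- `(P₁(u)/Q₁(u), P₂(u)/Q₂(u))`, with both fractions in reduced form, is a differential rational
parametrization of the differential curve `(𝒞, A)`, that is, a generic point of the general
component `𝒞 = 𝕍(sat(A))` of the irreducible differential polynomial `A`. -/
structure IsDiffRatParam (r : Ranking (Fin 2)) (A : DiffPoly (Fin 2) F) (u : E)
    (P Q : Fin 2 → DiffPoly Unit F) : Prop where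
  irreducible : Irreducible A
  transcendental : DiffTranscendental F u
  den_ne_zero : ∀ i, Q i ≠ 0
  reduced : ∀ i, IsRelPrime (P i) (Q i)
  generic : IsGenericPoint (paramPoint u P Q) (sat r A)

/-- All numerators and denominators have (total) degree at most one. -/
def IsLinearParam (P Q : Fin 2 → DiffPoly Unit F) : Prop :=
  ∀ i, (P i).totalDegree ≤ 1 ∧ (Q i).totalDegree ≤ 1

/-- The parametrization is proper: `F⟨P₁(u)/Q₁(u), P₂(u)/Q₂(u)⟩ = F⟨u⟩`. -/
def IsProperParam (u : E) (P Q : Fin 2 → DiffPoly Unit F) : Prop :=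
  diffAdjoin F (Set.range (paramPoint u P Q)) = diffAdjoin F {u}

end Parametrization

section Resultant

variable {D : Type*} [CommRing D] [Differential D]

/-- The differential resultant matrix of linear differential polynomials `f₁`, `f₂` in `u` of
orders `m₁`, `m₂`. The rows are the coefficient vectors of
`f₁^{(m₂)}, …, f₁', f₁, f₂^{(m₁)}, …, f₂', f₂` with respect to `u^{(m₁+m₂)}, …, u', u, 1`. -/
def diffResMatrix (m₁ m₂ : ℕ) (f₁ f₂ : DiffPoly Unit D) :
    Matrix (Fin (m₁ + m₂ + 2)) (Fin (m₁ + m₂ + 2)) D :=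
  Matrix.of fun i j =>
    coeff (if (j : ℕ) ≤ m₁ + m₂ then Finsupp.single ((), m₁ + m₂ - (j : ℕ)) 1 else 0)
      (if (i : ℕ) ≤ m₂ then iterDeriv (m₂ - (i : ℕ)) f₁
        else iterDeriv (m₁ + m₂ + 1 - (i : ℕ)) f₂)

/-- The differential resultant of two nonconstant linear differential polynomials in `u`. -/
def diffRes (f₁ f₂ : DiffPoly Unit D) : D :=
  (diffResMatrix ((ord f₁).unbotD 0) ((ord f₂).unbotD 0) f₁ f₂).det

end Resultant

section Implicit

variable {F : Type*} [Field F]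

/-- For `z = x` (`i = 0`) or `z = y` (`i = 1`), the differential polynomial `z Q(u) - P(u)` in `u`
over `F{x, y}`. -/
def implicitEq (i : Fin 2) (P Q : DiffPoly Unit F) : DiffPoly Unit (DiffPoly (Fin 2) F) :=
  C (X (i, 0)) * map C Q - map C P

/-- `A` is the main irreducible factor of `R`. -/
def IsMainIrreducibleFactor (A R : DiffPoly (Fin 2) F) : Prop :=
  Irreducible A ∧ A ∣ R ∧ ∀ B, R = A * B → ord B < ord R

end Implicit

end DiffAlg

end

/-! Write `η = (P₁/Q₁, P₂/Q₂)` for the point and let `ωᵢ ∈ E[∂]` be the linear part of `ηᵢ Qᵢ - Pᵢ`,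
an operator of order exactly `mᵢ`. Since `Pᵢ` and `Qᵢ` have degree at most one, the differential of
`ηᵢ` in the coordinates `du, du', …` is a nonzero multiple of `ωᵢ`. Properness expresses `u` through
derivatives of the `ηᵢ`. Taking differentials shows that `ω₁, ω₂` generate the unit left ideal of
`E[∂]`. Hence `ω₂` generates `E[∂]/E[∂]ω₁`, a space of dimension `m₁`, so `ω₂, …, ∂^(m₁-1) ω₂` are
independent modulo `E[∂]ω₁` (`iterate_notMem_sup`), and symmetrically.

At `η` the resultant matrix kills the vector `(u^(m₁+m₂), …, u, 1)`, so `R(η) = 0`. Only the row of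
`f₁^(m₂)` contains `x^(m₂)`, and linearly. The coefficient of `x^(m₂)` in `R` is therefore the
determinant with that row replaced by the coefficients of `Q₁`, whose pairing with the kernel vector
is `Q₁(u) ≠ 0`. Together with the independence above, this makes the coefficient nonzero at `η`
(`diffRes_linear`). The same holds for `y^(m₁)`.

The same independence bounds orders from below: differentiating `A(η) = 0` shows that the leader of
`A` has order at least `m₂` if it is a derivative of `x`, and at least `m₁` if one of `y`
(`le_of_diffEval_eq_zero`). So `R ∈ sat(A)` contains no proper derivative of the leader, and `A ∣ R`
(`dvd_of_mem_sat`). If `R = AB`, the product rule at `η`, where `A` vanishes, forces `x^(m₂)` and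
`y^(m₁)` to occur in `A`. As `R` has degree one in each, neither occurs in `B`. -/

noncomputable section

namespace DiffAlg

/-! ### Partial derivatives of polynomials -/

section Polynomials

variable {τ S : Type*} [CommRing S]

lemma induction_on_add_mul {p : MvPolynomial τ S → Prop} (f : MvPolynomial τ S)
    (C : ∀ a, p (C a)) (X : ∀ v, p (X v)) (add : ∀ f g, p f → p g → p (f + g))
    (mul : ∀ f g, p f → p g → p (f * g)) : p f :=
  MvPolynomial.induction_on f C add fun f v hf => mul f _ hf (X v)

lemma pderiv_eq_zero_of_mem_supported {s : Set τ} {v : τ} (hv : v ∉ s)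
    {f : MvPolynomial τ S} (hf : f ∈ supported S s) : pderiv v f = 0 :=
  pderiv_eq_zero_of_notMem_vars fun h => hv (mem_supported.1 hf h)

lemma pderiv_mem_supported {s : Set τ} (v : τ)
    {f : MvPolynomial τ S} (hf : f ∈ supported S s) : pderiv v f ∈ supported S s := by
  classical
  induction hf using Algebra.adjoin_induction with
  | mem x hx =>
    obtain ⟨w, hw, rfl⟩ := hx
    rw [pderiv_X, Pi.single_apply]
    split_ifs
    · exact one_mem _
    · exact zero_mem _
  | algebraMap a => rw [algebraMap_eq, pderiv_C]; exact zero_mem _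
  | add f g _ _ hf hg => rw [map_add]; exact add_mem hf hg
  | mul f g hf' hg' hf hg =>
    rw [Derivation.leibniz, smul_eq_mul, smul_eq_mul]
    exact add_mem (mul_mem hf' hg) (mul_mem hg' hf)

/-- Reading linear coefficients as values of partial derivatives at the origin lets commutation
rules for `pderiv` compute the rows of the resultant matrix. -/
lemma constantCoeff_pderiv (v : τ) (f : MvPolynomial τ S) :
    constantCoeff (pderiv v f) = coeff (Finsupp.single v 1) f := by
  classical
  rw [constantCoeff_eq, coeff_pderiv]
  simp

end Polynomials

/-! ### The derivation against partial derivatives and orders -/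

section DifferentialPolynomials

variable {σ R : Type*} [CommRing R] [Differential R]

lemma iterDeriv_zero (a : R) : iterDeriv 0 a = a := rfl

lemma iterDeriv_succ (k : ℕ) (a : R) :
    iterDeriv (k + 1) a = Differential.deriv (iterDeriv k a) :=
  Function.iterate_succ_apply' _ _ _

lemma constantCoeff_deriv (f : DiffPoly σ R) :
    constantCoeff (Differential.deriv f) = Differential.deriv (constantCoeff f) := by
  induction f using induction_on_add_mul with
  | C a => simp [deriv_C]
  | X v => obtain ⟨i, k⟩ := v; simp [deriv_X]
  | add f g hf hg => simp [hf, hg]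
  | mul f g hf hg => simp [hf, hg]

lemma pderiv_zero_deriv (i : σ) (f : DiffPoly σ R) :
    pderiv (i, 0) (Differential.deriv f) = Differential.deriv (pderiv (i, 0) f) := by
  classical
  induction f using induction_on_add_mul with
  | C a => simp [deriv_C]
  | X v =>
    obtain ⟨j, k⟩ := v
    rw [deriv_X, pderiv_X, pderiv_X, Pi.single_eq_of_ne (by simp)]
    by_cases h : (j, k) = (i, 0)
    · rw [h, Pi.single_eq_same, Derivation.map_one_eq_zero]
    · rw [Pi.single_eq_of_ne h, map_zero]
  | add f g hf hg => simp [hf, hg]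
  | mul f g hf hg => simp [hf, hg]; ring

/-- Both sides define derivations-up-to-commutator, so generators suffice. This commutator is the
source of the shift in `shiftDeriv`, for linear parts and for differentials alike. -/
lemma pderiv_succ_deriv (i : σ) (l : ℕ) (f : DiffPoly σ R) :
    pderiv (i, l + 1) (Differential.deriv f) =
      Differential.deriv (pderiv (i, l + 1) f) + pderiv (i, l) f := by
  classical
  induction f using induction_on_add_mul with
  | C a => simp [deriv_C]
  | X v =>
    obtain ⟨j, k⟩ := v
    rw [deriv_X, pderiv_X, pderiv_X, pderiv_X]
    have h0 : Differential.deriv ((Pi.single (i, l + 1) 1 : σ × ℕ → DiffPoly σ R) (j, k)) = 0 := by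
      by_cases h : (j, k) = (i, l + 1)
      · rw [h, Pi.single_eq_same, Derivation.map_one_eq_zero]
      · rw [Pi.single_eq_of_ne h, map_zero]
    rw [h0, zero_add]
    simp [Pi.single_apply]
  | add f g hf hg => simp [hf, hg]; ring
  | mul f g hf hg => simp [hf, hg]; ring

lemma deriv_mem_supported {s t : Set (σ × ℕ)} (hst : s ⊆ t)
    (hs : ∀ v ∈ s, (v.1, v.2 + 1) ∈ t) {f : DiffPoly σ R} (hf : f ∈ supported R s) :
    Differential.deriv f ∈ supported R t := by
  have hle := supported_mono (R := R) hst
  induction hf using Algebra.adjoin_induction with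
  | mem x hx =>
    obtain ⟨v, hv, rfl⟩ := hx
    rw [show v = (v.1, v.2) from rfl, deriv_X]
    exact Algebra.subset_adjoin ⟨_, hs v hv, rfl⟩
  | algebraMap a =>
    rw [algebraMap_eq, deriv_C]
    exact Subalgebra.algebraMap_mem _ _
  | add f g _ _ hf hg => rw [map_add]; exact add_mem hf hg
  | mul f g hf' hg' hf hg =>
    rw [Derivation.leibniz, smul_eq_mul, smul_eq_mul]
    exact add_mem (mul_mem (hle hf') hg) (mul_mem (hle hg') hf)

/-- The derivatives of the indeterminate `i` up to order `n`, and all derivatives of the others. -/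
def ordLE (i : σ) (n : ℕ) : Set (σ × ℕ) := {v | v.1 = i → v.2 ≤ n}

lemma ordLE_mono (i : σ) {n m : ℕ} (h : n ≤ m) : ordLE i n ⊆ ordLE i m :=
  fun _ hv hi => (hv hi).trans h

/-- The derivative of a differential polynomial is linear in the highest derivative. -/
lemma deriv_sub_mem_supported (i : σ) (n : ℕ) {f : DiffPoly σ R}
    (hf : f ∈ supported R (ordLE i n)) :
    Differential.deriv f - pderiv (i, n) f * X (i, n + 1) ∈ supported R (ordLE i n) := by
  classical
  induction hf using Algebra.adjoin_induction with
  | mem x hx =>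
    obtain ⟨⟨j, k⟩, hv, rfl⟩ := hx
    rw [deriv_X, pderiv_X]
    by_cases h : (j, k) = (i, n)
    · obtain ⟨rfl, rfl⟩ := Prod.mk.inj h
      simp
    · rw [Pi.single_eq_of_ne h, zero_mul, sub_zero]
      refine Algebra.subset_adjoin ⟨(j, k + 1), fun hj => ?_, rfl⟩
      have h1 : k ≤ n := hv hj
      have h2 : k ≠ n := fun hk => h (by rw [hk]; exact congrArg (·, n) hj)
      change k + 1 ≤ n
      omega
  | algebraMap a =>
    rw [algebraMap_eq, deriv_C, pderiv_C, zero_mul, sub_zero]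
    exact Subalgebra.algebraMap_mem _ _
  | add f g _ _ hf hg =>
    rw [map_add, map_add]
    convert add_mem hf hg using 1
    ring
  | mul f g hf' hg' hf hg =>
    rw [Derivation.leibniz, Derivation.leibniz]
    simp only [smul_eq_mul]
    have h := add_mem (mul_mem hf' hg) (mul_mem hg' hf)
    convert h using 1
    · rfl
    · ring

/-- Each differentiation raises the top derivative by one and keeps its coefficient, so the same
partial derivative multiplies the top derivative in every `f^(k+1)`. -/
lemma iterDeriv_succ_sub_mem_supported (i : σ) (n : ℕ) {f : DiffPoly σ R}
    (hf : f ∈ supported R (ordLE i n)) (k : ℕ) :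
    iterDeriv (k + 1) f - pderiv (i, n) f * X (i, n + k + 1) ∈ supported R (ordLE i (n + k)) := by
  induction k with
  | zero => exact deriv_sub_mem_supported i n hf
  | succ k ih =>
    have hS := pderiv_mem_supported (i, n) hf
    set S := pderiv (i, n) f
    have hmem : iterDeriv (k + 1) f ∈ supported R (ordLE i (n + k + 1)) := by
      rw [← sub_add_cancel (iterDeriv (k + 1) f) (S * X (i, n + k + 1))]
      refine add_mem (supported_mono (ordLE_mono i (by omega)) ih)
        (mul_mem (supported_mono (ordLE_mono i (by omega)) hS) ?_)
      exact Algebra.subset_adjoin ⟨_, fun _ => le_rfl, rfl⟩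
    have hp : pderiv (i, n + k + 1) (iterDeriv (k + 1) f) = S := by
      have h1 := pderiv_eq_zero_of_mem_supported (v := (i, n + k + 1)) (s := ordLE i (n + k))
        (fun h => by have := h rfl; simp at this) ih
      have h2 := pderiv_eq_zero_of_mem_supported (v := (i, n + k + 1)) (s := ordLE i n)
        (fun h => by have := h rfl; simp at this) hS
      rw [map_sub, Derivation.leibniz, h2, pderiv_X_self, sub_eq_zero] at h1
      simpa using h1
    have := deriv_sub_mem_supported i (n + k + 1) hmem
    rwa [hp, ← iterDeriv_succ] at this

lemma iterDeriv_mem_supported (i : σ) (n : ℕ) {f : DiffPoly σ R}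
    (hf : f ∈ supported R (ordLE i n)) (k : ℕ) :
    iterDeriv k f ∈ supported R (ordLE i (n + k)) := by
  induction k with
  | zero => exact hf
  | succ k ih =>
    rw [iterDeriv_succ]
    exact deriv_mem_supported (ordLE_mono i (by omega))
      (fun v hv hi => Nat.succ_le_succ (hv hi)) ih

end DifferentialPolynomials

/-! ### Linear parts as differential operators -/

section Rows

variable {R : Type*} [CommRing R] [Differential R]

/-- The action of the derivation on the linear operators `∑ ω k • ∂ ^ k`, given by their
coefficient sequences: `(shiftDeriv ω) k = (ω k)' + ω (k - 1)`. -/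
def shiftDeriv : (ℕ → R) →+ (ℕ → R) :=
  -- The entry taken for `ω (k - 1)` at `k = 0` is `0`, not `ω 0`.
  AddMonoidHom.mk' (fun ω k => Differential.deriv (ω k) + Nat.casesOn k 0 ω) (by
    intro a b
    ext k
    cases k
    · simp
    · simp only [Pi.add_apply, map_add]; ring)

lemma shiftDeriv_apply_zero (ω : ℕ → R) : shiftDeriv ω 0 = Differential.deriv (ω 0) := by
  simp [shiftDeriv]

lemma shiftDeriv_apply_succ (ω : ℕ → R) (k : ℕ) :
    shiftDeriv ω (k + 1) = Differential.deriv (ω (k + 1)) + ω k := rfl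

/-- The commutation rule `∂ a = a ∂ + a'` of the ring of differential operators. -/
lemma shiftDeriv_smul (a : R) (ω : ℕ → R) :
    shiftDeriv (a • ω) = a • shiftDeriv ω + Differential.deriv a • ω := by
  ext k
  cases k with
  | zero => simp [shiftDeriv_apply_zero]; ring
  | succ k => simp [shiftDeriv_apply_succ]; ring

/-- The coefficients of the linear part of a differential polynomial in one indeterminate. -/
def linearPart (f : DiffPoly Unit R) : ℕ → R := fun k => coeff (Finsupp.single ((), k) 1) f

lemma linearPart_deriv (f : DiffPoly Unit R) :
    linearPart (Differential.deriv f) = shiftDeriv (linearPart f) := by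
  ext k
  unfold linearPart
  cases k with
  | zero =>
    rw [shiftDeriv_apply_zero, ← constantCoeff_pderiv, pderiv_zero_deriv, constantCoeff_deriv,
      constantCoeff_pderiv]
  | succ k =>
    rw [shiftDeriv_apply_succ, ← constantCoeff_pderiv, pderiv_succ_deriv, map_add,
      constantCoeff_deriv, constantCoeff_pderiv, constantCoeff_pderiv]

lemma linearPart_iterDeriv (k : ℕ) (f : DiffPoly Unit R) :
    linearPart (iterDeriv k f) = shiftDeriv^[k] (linearPart f) := by
  induction k with
  | zero => rfl
  | succ k ih => rw [iterDeriv_succ, linearPart_deriv, ih, Function.iterate_succ_apply']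

lemma coeff_zero_iterDeriv (k : ℕ) (f : DiffPoly Unit R) :
    coeff 0 (iterDeriv k f) = iterDeriv k (coeff 0 f) := by
  induction k with
  | zero => rfl
  | succ k ih =>
    rw [iterDeriv_succ, iterDeriv_succ, ← ih, ← constantCoeff_eq, constantCoeff_deriv,
      constantCoeff_eq]

lemma shiftDeriv_iterate_eq_zero {ω : ℕ → R} {m : ℕ} (h : ∀ k, m < k → ω k = 0) (j : ℕ) :
    ∀ k, m + j < k → (shiftDeriv^[j] ω) k = 0 := by
  induction j with
  | zero => exact h
  | succ j ih =>
    intro k hk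
    obtain ⟨k, rfl⟩ : ∃ l, k = l + 1 := ⟨k - 1, by omega⟩
    rw [Function.iterate_succ_apply', shiftDeriv_apply_succ, ih _ (by omega), ih _ (by omega),
      map_zero, add_zero]

lemma shiftDeriv_iterate_apply_top {ω : ℕ → R} {m : ℕ} (h : ∀ k, m < k → ω k = 0) (j : ℕ) :
    (shiftDeriv^[j] ω) (m + j) = ω m := by
  induction j with
  | zero => rfl
  | succ j ih =>
    rw [Function.iterate_succ_apply', ← add_assoc, shiftDeriv_apply_succ, ih,
      shiftDeriv_iterate_eq_zero h j _ (by omega), map_zero, zero_add]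

lemma map_iterDeriv {S : Type*} [CommRing S] [Differential S] (φ : R →+* S)
    (hφ : ∀ a, φ (Differential.deriv a) = Differential.deriv (φ a)) (k : ℕ) (a : R) :
    φ (iterDeriv k a) = iterDeriv k (φ a) := by
  induction k with
  | zero => rfl
  | succ k ih => rw [iterDeriv_succ, iterDeriv_succ, hφ, ih]

lemma comp_shiftDeriv_iterate {S : Type*} [CommRing S] [Differential S] (φ : R →+* S)
    (hφ : ∀ a, φ (Differential.deriv a) = Differential.deriv (φ a)) (j : ℕ) (ω : ℕ → R) :
    φ ∘ (shiftDeriv^[j] ω) = shiftDeriv^[j] (φ ∘ ω) := by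
  induction j with
  | zero => rfl
  | succ j ih =>
    rw [Function.iterate_succ_apply', Function.iterate_succ_apply', ← ih]
    ext k
    cases k with
    | zero => simp [shiftDeriv_apply_zero, hφ]
    | succ k => simp [shiftDeriv_apply_succ, hφ]

end Rows

/-! ### Left ideals of operators and independence of Sylvester rows -/

section Spans

variable {K : Type*} [Field K] [Differential K]

/-- The span of `ω, ∂ω, …, ∂^(t-1) ω`. -/
def derivSpan (ω : ℕ → K) (t : ℕ) : Submodule K (ℕ → K) :=
  Submodule.span K ((fun j => shiftDeriv^[j] ω) '' Set.Iio t)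

/-- The span of all `∂^j ω`. -/
def derivSpanTop (ω : ℕ → K) : Submodule K (ℕ → K) :=
  Submodule.span K (Set.range fun j => shiftDeriv^[j] ω)

lemma derivSpan_mono (ω : ℕ → K) {s t : ℕ} (h : s ≤ t) : derivSpan ω s ≤ derivSpan ω t :=
  Submodule.span_mono (Set.image_mono (Set.Iio_subset_Iio h))

lemma derivSpan_le_top (ω : ℕ → K) (t : ℕ) : derivSpan ω t ≤ derivSpanTop ω :=
  Submodule.span_mono (Set.image_subset_range _ _)

lemma iterate_mem_derivSpan (ω : ℕ → K) {j t : ℕ} (h : j < t) :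
    shiftDeriv^[j] ω ∈ derivSpan ω t :=
  Submodule.subset_span ⟨j, h, rfl⟩

lemma iterate_mem_derivSpanTop (ω : ℕ → K) (j : ℕ) : shiftDeriv^[j] ω ∈ derivSpanTop ω :=
  Submodule.subset_span ⟨j, rfl⟩

lemma shiftDeriv_mem_of_mem_span {s : Set (ℕ → K)} {U : Submodule K (ℕ → K)}
    (hs : s ⊆ U) (h : ∀ x ∈ s, shiftDeriv x ∈ U) {x : ℕ → K} (hx : x ∈ Submodule.span K s) :
    shiftDeriv x ∈ U := by
  induction hx using Submodule.span_induction with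
  | mem x hx => exact h x hx
  | zero => rw [map_zero]; exact zero_mem _
  | add x y _ _ hx hy => rw [map_add]; exact add_mem hx hy
  | smul a x hx hx' =>
    rw [shiftDeriv_smul]
    exact add_mem (U.smul_mem _ hx') (U.smul_mem _ (Submodule.span_le.2 hs hx))

lemma shiftDeriv_mem_derivSpan {ω x : ℕ → K} {t : ℕ} (hx : x ∈ derivSpan ω t) :
    shiftDeriv x ∈ derivSpan ω (t + 1) := by
  refine shiftDeriv_mem_of_mem_span ?_ ?_ hx
  · rintro _ ⟨j, hj, rfl⟩
    exact iterate_mem_derivSpan ω (Nat.lt_succ_of_lt hj)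
  · rintro _ ⟨j, hj, rfl⟩
    rw [← Function.iterate_succ_apply' shiftDeriv]
    exact iterate_mem_derivSpan ω (Nat.succ_lt_succ hj)

lemma shiftDeriv_mem_derivSpanTop {ω x : ℕ → K} (hx : x ∈ derivSpanTop ω) :
    shiftDeriv x ∈ derivSpanTop ω := by
  refine shiftDeriv_mem_of_mem_span Submodule.subset_span ?_ hx
  rintro _ ⟨j, rfl⟩
  rw [← Function.iterate_succ_apply' shiftDeriv]
  exact iterate_mem_derivSpanTop ω _

lemma exists_mem_derivSpan {ω x : ℕ → K} (hx : x ∈ derivSpanTop ω) :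
    ∃ t, x ∈ derivSpan ω t := by
  induction hx using Submodule.span_induction with
  | mem x hx =>
    obtain ⟨j, rfl⟩ := hx
    exact ⟨j + 1, iterate_mem_derivSpan ω j.lt_succ_self⟩
  | zero => exact ⟨0, zero_mem _⟩
  | add x y _ _ hx hy =>
    obtain ⟨s, hs⟩ := hx
    obtain ⟨t, ht⟩ := hy
    exact ⟨max s t, add_mem (derivSpan_mono ω (le_max_left s t) hs)
      (derivSpan_mono ω (le_max_right s t) ht)⟩
  | smul a x _ hx =>
    obtain ⟨t, ht⟩ := hx
    exact ⟨t, Submodule.smul_mem _ a ht⟩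

lemma derivSpan_succ (ω : ℕ → K) (t : ℕ) :
    derivSpan ω (t + 1) = Submodule.span K {shiftDeriv^[t] ω} ⊔ derivSpan ω t := by
  rw [derivSpan, derivSpan, ← Submodule.span_union, ← Order.succ_eq_add_one, Order.Iio_succ,
    ← Set.Iio_insert, Set.image_insert_eq, Set.insert_eq]

lemma apply_eq_zero_of_mem_derivSpan {ω : ℕ → K} {m : ℕ} (hω : ∀ k, m < k → ω k = 0) {t : ℕ}
    {x : ℕ → K} (hx : x ∈ derivSpan ω t) (k : ℕ) (hk : m + t ≤ k) : x k = 0 := by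
  induction hx using Submodule.span_induction with
  | mem x hx =>
    obtain ⟨j, hj, rfl⟩ := hx
    have hj : j < t := hj
    exact shiftDeriv_iterate_eq_zero hω j k (by omega)
  | zero => rfl
  | add x y _ _ hx hy => rw [Pi.add_apply, hx, hy, add_zero]
  | smul a x _ hx => rw [Pi.smul_apply, hx, smul_zero]

/-- A nonzero left multiple of an operator of order `m` has order at least `m`. -/
lemma eq_zero_of_mem_derivSpan {ω : ℕ → K} {m : ℕ} (hω : ∀ k, m < k → ω k = 0) (hm : ω m ≠ 0)
    {t : ℕ} {x : ℕ → K} (hx : x ∈ derivSpan ω t) (h : ∀ k, m ≤ k → x k = 0) : x = 0 := by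
  induction t generalizing x with
  | zero => simpa [derivSpan] using hx
  | succ t ih =>
    rw [derivSpan_succ, Submodule.mem_sup] at hx
    obtain ⟨y, hy, z, hz, rfl⟩ := hx
    obtain ⟨a, rfl⟩ := Submodule.mem_span_singleton.1 hy
    have h1 := h (m + t) (by omega)
    rw [Pi.add_apply, apply_eq_zero_of_mem_derivSpan hω hz _ le_rfl, add_zero, Pi.smul_apply,
      shiftDeriv_iterate_apply_top hω, smul_eq_mul] at h1
    obtain rfl := (mul_eq_zero.1 h1).resolve_right hm
    rw [zero_smul, zero_add] at h ⊢
    exact ih hz h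

lemma iterate_notMem_derivSpan {ω : ℕ → K} {m : ℕ} (hω : ∀ k, m < k → ω k = 0) (hm : ω m ≠ 0)
    (t : ℕ) : shiftDeriv^[t] ω ∉ derivSpan ω t := fun h => by
  have := apply_eq_zero_of_mem_derivSpan hω h (m + t) le_rfl
  rw [shiftDeriv_iterate_apply_top hω] at this
  exact hm this

/-- If `ω₁`, `ω₂` generate the unit operator, `ω₁` having order `m`, then
`ω₂, ∂ω₂, …, ∂^(m-1) ω₂` are independent modulo the left multiples of `ω₁`. -/
lemma iterate_notMem_sup {ω₁ ω₂ : ℕ → K} {m : ℕ} (hω : ∀ k, m < k → ω₁ k = 0) (hm : ω₁ m ≠ 0)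
    (h1 : (Pi.single 0 1 : ℕ → K) ∈ derivSpanTop ω₁ ⊔ derivSpanTop ω₂) {p : ℕ} (hp : p < m) :
    shiftDeriv^[p] ω₂ ∉ derivSpanTop ω₁ ⊔ derivSpan ω₂ p := by
  intro hmem
  set V := derivSpanTop ω₁ with hV
  set U := V ⊔ derivSpan ω₂ p with hU
  -- If `∂^p ω₂` already lies in `U`, then `U` is closed under `∂`. It then contains every `∂^j ω₂`,
  -- hence the unit operator and all powers of `∂`.
  have hstable : ∀ x ∈ U, shiftDeriv x ∈ U := by
    intro x hx
    obtain ⟨y, hy, z, hz, rfl⟩ := Submodule.mem_sup.1 hx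
    rw [map_add]
    refine add_mem (Submodule.mem_sup_left (shiftDeriv_mem_derivSpanTop hy)) ?_
    have hz' := shiftDeriv_mem_derivSpan hz
    rw [derivSpan_succ] at hz'
    exact (sup_le (Submodule.span_le.2 (Set.singleton_subset_iff.2 hmem)) le_sup_right :
      _ ≤ U) hz'
  have hω₂ : ∀ j, shiftDeriv^[j] ω₂ ∈ U := by
    intro j
    induction j with
    | zero =>
      rcases Nat.eq_zero_or_pos p with h0 | h0
      · simpa only [h0] using hmem
      · exact Submodule.mem_sup_right (iterate_mem_derivSpan ω₂ h0)
    | succ j ih => rw [Function.iterate_succ_apply']; exact hstable _ ih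
  have hle : V ⊔ derivSpanTop ω₂ ≤ U :=
    sup_le le_sup_left (Submodule.span_le.2 (by rintro _ ⟨j, rfl⟩; exact hω₂ j))
  have he : ∀ k, (Pi.single k 1 : ℕ → K) ∈ U := by
    intro k
    induction k with
    | zero => exact hle h1
    | succ k ih =>
      convert hstable _ ih using 1
      ext l
      cases l with
      | zero =>
        rw [shiftDeriv_apply_zero, Pi.single_eq_of_ne (by simp)]
        cases k with
        | zero => simp
        | succ k => rw [Pi.single_eq_of_ne (by simp), map_zero]
      | succ l =>
        rw [shiftDeriv_apply_succ]
        have h0 : Differential.deriv ((Pi.single k 1 : ℕ → K) (l + 1)) = 0 := by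
          by_cases h : l + 1 = k
          · rw [h, Pi.single_eq_same, Derivation.map_one_eq_zero]
          · rw [Pi.single_eq_of_ne h, map_zero]
        rw [h0, zero_add]
        simp [Pi.single_apply]
  -- Nonzero elements of `V` have order at least `m`, so `1, ∂, …, ∂^(m-1)` are independent modulo
  -- `V`. They cannot all lie in the quotient `U/V`, which is spanned by `p < m` elements.
  have hind : LinearIndependent K fun k : Fin m => V.mkQ (Pi.single (k : ℕ) (1 : K)) := by
    rw [Fintype.linearIndependent_iff]
    intro c hc i
    have hcV : (∑ k : Fin m, c k • (Pi.single (k : ℕ) 1 : ℕ → K)) ∈ V := by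
      rw [← Submodule.ker_mkQ V, LinearMap.mem_ker, map_sum]
      simpa only [map_smul] using hc
    obtain ⟨t, ht⟩ := exists_mem_derivSpan hcV
    have happ : ∀ j : ℕ, (∑ k : Fin m, c k • (Pi.single (k : ℕ) 1 : ℕ → K)) j =
        ∑ k : Fin m, if j = k then c k else 0 := by
      intro j
      simp [Finset.sum_apply, Pi.single_apply]
    have h0 := eq_zero_of_mem_derivSpan hω hm ht (fun j hj => by
      rw [happ]
      exact Finset.sum_eq_zero fun k _ => if_neg (by omega))
    have hi := congrFun h0 i
    rw [happ] at hi
    simpa [Fin.val_inj] using hi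
  have hspan : Set.range (fun k : Fin m => V.mkQ (Pi.single (k : ℕ) (1 : K))) ⊆
      (Submodule.span K (Set.range fun j : Fin p => V.mkQ (shiftDeriv^[(j : ℕ)] ω₂)) :
        Submodule K _) := by
    rintro _ ⟨k, rfl⟩
    obtain ⟨y, hy, z, hz, hyz⟩ := Submodule.mem_sup.1 (he k)
    simp only [← hyz, map_add]
    rw [(V.mkQ_apply y).trans ((Submodule.Quotient.mk_eq_zero V).2 hy), zero_add]
    have hz' := Submodule.mem_map_of_mem (f := V.mkQ) hz
    rw [derivSpan, Submodule.map_span] at hz'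
    refine Submodule.span_mono ?_ hz'
    rintro _ ⟨_, ⟨j, hj, rfl⟩, rfl⟩
    exact ⟨⟨j, hj⟩, rfl⟩
  classical
  have hcard := linearIndependent_le_span_aux' _ hind _ hspan
  have hcard' := Fintype.card_le_of_surjective _
    (Set.rangeFactorization_surjective (f := fun j : Fin p => V.mkQ (shiftDeriv^[(j : ℕ)] ω₂)))
  rw [Fintype.card_fin] at hcard hcard'
  omega

lemma sum_range_smul_mem_derivSpan (ω : ℕ → K) (a : ℕ → K) (s : ℕ) :
    ∑ k ∈ Finset.range s, a k • shiftDeriv^[k] ω ∈ derivSpan ω s :=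
  sum_mem fun _ hk => Submodule.smul_mem _ _ (iterate_mem_derivSpan ω (Finset.mem_range.1 hk))

/-- Dividing by a nonzero last coefficient would place the last iterate in the span of `V` and the
earlier ones; the other coefficients follow by induction. -/
lemma eq_zero_of_sum_iterate_eq_zero {V : Submodule K (ℕ → K)} {ω : ℕ → K} {t : ℕ}
    (hω : ∀ p < t, shiftDeriv^[p] ω ∉ V ⊔ derivSpan ω p) {b : ℕ → K}
    (h : ∑ k ∈ Finset.range t, b k • shiftDeriv^[k] ω ∈ V) : ∀ k < t, b k = 0 := by
  induction t with
  | zero => simp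
  | succ t ih =>
    have hbt : b t = 0 := by
      by_contra hb
      refine hω t t.lt_succ_self ?_
      rw [← inv_smul_smul₀ hb (shiftDeriv^[t] ω)]
      refine Submodule.smul_mem _ _ ?_
      rw [Finset.sum_range_succ] at h
      rw [← add_sub_cancel_left (∑ k ∈ Finset.range t, b k • shiftDeriv^[k] ω)
        (b t • shiftDeriv^[t] ω)]
      exact sub_mem (Submodule.mem_sup_left h)
        (Submodule.mem_sup_right (sum_range_smul_mem_derivSpan ω b t))
    intro k hk
    rcases Nat.lt_succ_iff_lt_or_eq.1 hk with hk | rfl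
    · refine ih (fun p hp => hω p (by omega)) ?_ k hk
      rwa [Finset.sum_range_succ, hbt, zero_smul, add_zero] at h
    · exact hbt

/-- The rows of the Sylvester matrix of two operators that generate the unit operator. -/
lemma eq_zero_of_sum_add_sum_eq_zero {ω₁ ω₂ : ℕ → K} {m : ℕ} (hω : ∀ k, m < k → ω₁ k = 0)
    (hm : ω₁ m ≠ 0) (h1 : (Pi.single 0 1 : ℕ → K) ∈ derivSpanTop ω₁ ⊔ derivSpanTop ω₂)
    {s t : ℕ} (ht : t ≤ m) {a b : ℕ → K}
    (h : ∑ k ∈ Finset.range s, a k • shiftDeriv^[k] ω₁ +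
      ∑ k ∈ Finset.range t, b k • shiftDeriv^[k] ω₂ = 0) :
    (∀ k < s, a k = 0) ∧ ∀ k < t, b k = 0 := by
  have hb : ∀ k < t, b k = 0 := by
    refine eq_zero_of_sum_iterate_eq_zero (V := derivSpanTop ω₁)
      (fun p hp => iterate_notMem_sup hω hm h1 (by omega)) ?_
    rw [eq_neg_of_add_eq_zero_right h]
    exact neg_mem (derivSpan_le_top _ _ (sum_range_smul_mem_derivSpan ω₁ a s))
  refine ⟨eq_zero_of_sum_iterate_eq_zero (V := ⊥)
    (fun p _ => by rw [bot_sup_eq]; exact iterate_notMem_derivSpan hω hm p) ?_, hb⟩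
  rwa [Finset.sum_eq_zero (s := Finset.range t) fun k hk => by
    rw [hb k (Finset.mem_range.1 hk), zero_smul], add_zero] at h

end Spans

/-! ### Differentials of elements of `F⟨u⟩` -/

section Differentials

variable {F E : Type*} [Field F] [Field E] [Differential E] [Algebra F E]

lemma diffEval_X {σ : Type*} (η : σ → E) (v : σ × ℕ) :
    diffEval η (X v : DiffPoly σ F) = iterDeriv v.2 (η v.1) := aeval_X _ _

lemma diffEval_C {σ : Type*} (η : σ → E) (a : F) :
    diffEval η (C a : DiffPoly σ F) = algebraMap F E a := aeval_C _ _

lemma diffEval_deriv [Differential F] [DifferentialAlgebra F E] {σ : Type*} (η : σ → E)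
    (f : DiffPoly σ F) :
    diffEval η (Differential.deriv f) = Differential.deriv (diffEval η f) := by
  induction f using induction_on_add_mul with
  | C a => rw [deriv_C, diffEval_C, diffEval_C, deriv_algebraMap]
  | X v =>
    obtain ⟨i, k⟩ := v
    rw [deriv_X, diffEval_X, diffEval_X, iterDeriv_succ]
  | add f g hf hg => simp [hf, hg]
  | mul f g hf hg => simp [hf, hg]

lemma DiffTranscendental.injective {u : E} (hu : DiffTranscendental F u) :
    Function.Injective (diffEval fun _ : Unit => u : DiffPoly Unit F →ₐ[F] E) :=
  AlgebraicIndependent.comp hu (fun v : Unit × ℕ => v.2) fun _ _ h => Prod.ext rfl h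

/-- The coefficients of the differential `dp = ∑ (∂p/∂u^(k)) du^(k)` at `u`. -/
def gradient (u : E) (p : DiffPoly Unit F) : ℕ → E :=
  fun k => diffEval (fun _ => u) (pderiv ((), k) p)

lemma gradient_deriv [Differential F] [DifferentialAlgebra F E] (u : E) (p : DiffPoly Unit F) :
    gradient u (Differential.deriv p) = shiftDeriv (gradient u p) := by
  ext k
  cases k with
  | zero => rw [shiftDeriv_apply_zero, gradient, pderiv_zero_deriv, diffEval_deriv, gradient]
  | succ k =>
    rw [shiftDeriv_apply_succ, gradient, pderiv_succ_deriv, map_add, diffEval_deriv, gradient]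
    rfl

lemma gradient_mul (u : E) (p q : DiffPoly Unit F) (k : ℕ) :
    gradient u (p * q) k = diffEval (fun _ => u) p * gradient u q k +
      diffEval (fun _ => u) q * gradient u p k := by
  simp [gradient]

lemma gradient_add (u : E) (p q : DiffPoly Unit F) (k : ℕ) :
    gradient u (p + q) k = gradient u p k + gradient u q k := by
  simp [gradient]

lemma gradient_sub (u : E) (p q : DiffPoly Unit F) (k : ℕ) :
    gradient u (p - q) k = gradient u p k - gradient u q k := by
  simp [gradient]

variable (F) in
/-- `a = p(u)/q(u)` has differential `ω`, in the coordinates `du, du', du'', …`. -/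
def HasDifferential (u a : E) (ω : ℕ → E) : Prop :=
  ∃ p q : DiffPoly Unit F, diffEval (fun _ => u) q ≠ 0 ∧
    a * diffEval (fun _ => u) q = diffEval (fun _ => u) p ∧
    ∀ k, diffEval (fun _ => u) q * ω k = gradient u p k - a * gradient u q k

namespace HasDifferential

variable {u a b : E} {ω θ : ℕ → E}

lemma algebraMap (u : E) (c : F) : HasDifferential F u (algebraMap F E c) 0 :=
  ⟨C c, 1, by simp, by simp, fun k => by simp [gradient]⟩

lemma add (ha : HasDifferential F u a ω) (hb : HasDifferential F u b θ) :
    HasDifferential F u (a + b) (ω + θ) := by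
  obtain ⟨p, q, hq, hpq, h⟩ := ha
  obtain ⟨p', q', hq', hpq', h'⟩ := hb
  refine ⟨p * q' + p' * q, q * q', ?_, ?_, fun k => ?_⟩
  · rw [map_mul]; exact mul_ne_zero hq hq'
  · simp only [map_add, map_mul]
    linear_combination diffEval (fun _ => u) q' * hpq + diffEval (fun _ => u) q * hpq'
  · simp only [gradient_add, gradient_mul, map_mul, Pi.add_apply]
    rw [← hpq, ← hpq']
    linear_combination diffEval (fun _ => u) q' * h k + diffEval (fun _ => u) q * h' k

lemma mul (ha : HasDifferential F u a ω) (hb : HasDifferential F u b θ) :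
    HasDifferential F u (a * b) (a • θ + b • ω) := by
  obtain ⟨p, q, hq, hpq, h⟩ := ha
  obtain ⟨p', q', hq', hpq', h'⟩ := hb
  refine ⟨p * p', q * q', ?_, ?_, fun k => ?_⟩
  · rw [map_mul]; exact mul_ne_zero hq hq'
  · simp only [map_mul]
    rw [← hpq, ← hpq']
    ring
  · simp only [gradient_mul, map_mul, Pi.add_apply, Pi.smul_apply, smul_eq_mul]
    rw [← hpq, ← hpq']
    linear_combination b * diffEval (fun _ => u) q' * h k + a * diffEval (fun _ => u) q * h' k

lemma inv (ha : HasDifferential F u a ω) (h0 : a ≠ 0) :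
    HasDifferential F u a⁻¹ (-(a⁻¹ * a⁻¹) • ω) := by
  obtain ⟨p, q, hq, hpq, h⟩ := ha
  refine ⟨q, p, ?_, ?_, fun k => ?_⟩
  · rw [← hpq]; exact mul_ne_zero h0 hq
  · rw [← hpq, inv_mul_cancel_left₀ h0]
  · rw [← hpq]
    simp only [Pi.smul_apply, smul_eq_mul]
    field_simp
    linear_combination -h k

/-- Obtained by differentiating both `a q = p` and `q ω + a dq = dp`, and combining the results over
the denominator `q²`. -/
lemma deriv [Differential F] [DifferentialAlgebra F E] (ha : HasDifferential F u a ω) :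
    HasDifferential F u (Differential.deriv a) (shiftDeriv ω) := by
  obtain ⟨p, q, hq, hpq, h⟩ := ha
  have hpq' := congrArg (⇑(Differential.deriv : Derivation ℤ E E)) hpq
  rw [Derivation.leibniz, smul_eq_mul, smul_eq_mul] at hpq'
  have h' : diffEval (fun _ => u) q • ω + a • gradient u q = gradient u p := by
    ext k
    simp [h k]
  have h'' := congrArg shiftDeriv h'
  rw [map_add, shiftDeriv_smul, shiftDeriv_smul] at h''
  refine ⟨Differential.deriv p * q - p * Differential.deriv q, q * q, ?_, ?_, fun k => ?_⟩
  · rw [map_mul]; exact mul_ne_zero hq hq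
  · simp only [map_sub, map_mul, diffEval_deriv]
    rw [← hpq', ← hpq]
    ring
  · have hk := congrFun h'' k
    simp only [Pi.add_apply, Pi.smul_apply, smul_eq_mul] at hk
    simp only [gradient_sub, gradient_mul, gradient_deriv, map_mul, diffEval_deriv]
    rw [← hpq', ← hpq]
    linear_combination diffEval (fun _ => u) q * hk -
      Differential.deriv (diffEval (fun _ => u) q) * h k

/-- Differential transcendence makes `p(u) = 0` an identity `p = 0`, so the differential cannot
depend on the fraction chosen for `0`. -/
lemma eq_zero (hu : DiffTranscendental F u) (h : HasDifferential F u 0 ω) : ω = 0 := by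
  obtain ⟨p, q, hq, hpq, h⟩ := h
  rw [zero_mul] at hpq
  have hp : p = 0 := hu.injective (by rw [← hpq, map_zero])
  ext k
  have := h k
  rw [hp] at this
  simpa [gradient, hq] using this

lemma eq_single (hu : DiffTranscendental F u) (h : HasDifferential F u u ω) :
    ω = Pi.single 0 1 := by
  classical
  obtain ⟨p, q, hq, hpq, h⟩ := h
  have hp : p = X ((), 0) * q := hu.injective (by rw [← hpq, map_mul, diffEval_X]; rfl)
  ext k
  have := h k
  rw [hp, gradient_mul, diffEval_X] at this
  simp only [iterDeriv_zero, add_sub_cancel_left] at this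
  rw [mul_left_cancel₀ hq this, gradient, pderiv_X]
  simp only [Pi.single_apply, Prod.mk.injEq, true_and, eq_comm (a := k)]
  split_ifs <;> simp

/-- An element given by a fraction of polynomials in `u, u', …`. -/
lemma div {p q : DiffPoly Unit F} (hq : diffEval (fun _ => u) q ≠ 0) :
    HasDifferential F u (diffEval (fun _ => u) p / diffEval (fun _ => u) q)
      ((-(diffEval (fun _ => u) q)⁻¹) •
        ((diffEval (fun _ => u) p / diffEval (fun _ => u) q) • gradient u q - gradient u p)) := by
  refine ⟨p, q, hq, div_mul_cancel₀ _ hq, fun k => ?_⟩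
  simp only [Pi.smul_apply, Pi.sub_apply, smul_eq_mul]
  field_simp
  ring

/-- The differential of a derivative of `a` is given by the derivatives of that of `a`. -/
lemma iterDeriv [Differential F] [DifferentialAlgebra F E] {c : E}
    (ha : HasDifferential F u a (c • ω)) (k : ℕ) :
    ∃ θ ∈ derivSpan ω k, HasDifferential F u (iterDeriv k a) (c • shiftDeriv^[k] ω + θ) := by
  induction k with
  | zero => exact ⟨0, zero_mem _, by simpa [DiffAlg.iterDeriv_zero] using ha⟩
  | succ k ih =>
    obtain ⟨θ, hθ, h⟩ := ih
    refine ⟨Differential.deriv c • shiftDeriv^[k] ω + shiftDeriv θ,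
      add_mem (Submodule.smul_mem _ _ (iterate_mem_derivSpan ω k.lt_succ_self))
        (shiftDeriv_mem_derivSpan hθ), ?_⟩
    rw [iterDeriv_succ, Function.iterate_succ_apply', ← add_assoc, ← shiftDeriv_smul, ← map_add]
    exact h.deriv

lemma iterDeriv' [Differential F] [DifferentialAlgebra F E] {c : E}
    (ha : HasDifferential F u a (c • ω)) (k : ℕ) :
    ∃ θ ∈ derivSpan ω (k + 1), HasDifferential F u (DiffAlg.iterDeriv k a) θ := by
  obtain ⟨θ, hθ, h⟩ := ha.iterDeriv k
  exact ⟨_, add_mem (Submodule.smul_mem _ _ (iterate_mem_derivSpan ω k.lt_succ_self))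
    (derivSpan_mono ω k.le_succ hθ), h⟩

/-- Elements with a differential in `W` are closed under the field operations. Applied to `u` and
the two coordinates, this turns properness into a statement about left ideals. -/
lemma of_mem_diffAdjoin {W : Submodule E (ℕ → E)} {S : Set E}
    (hS : ∀ s ∈ S, ∀ k, ∃ ω ∈ W, HasDifferential F u (DiffAlg.iterDeriv k s) ω)
    (ha : a ∈ diffAdjoin F S) : ∃ ω ∈ W, HasDifferential F u a ω := by
  induction ha using IntermediateField.adjoin_induction with
  | mem x hx => obtain ⟨s, hs, k, rfl⟩ := hx; exact hS s hs k
  | algebraMap c => exact ⟨0, zero_mem _, algebraMap u c⟩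
  | add x y _ _ hx hy =>
    obtain ⟨ω, hω, hx⟩ := hx
    obtain ⟨θ, hθ, hy⟩ := hy
    exact ⟨_, add_mem hω hθ, hx.add hy⟩
  | inv x _ hx =>
    obtain ⟨ω, hω, hx⟩ := hx
    by_cases h : x = 0
    · rw [h, inv_zero]
      exact ⟨0, zero_mem _, by simpa using algebraMap u (0 : F)⟩
    · exact ⟨_, W.smul_mem _ hω, hx.inv h⟩
  | mul x y _ _ hx hy =>
    obtain ⟨ω, hω, hx⟩ := hx
    obtain ⟨θ, hθ, hy⟩ := hy
    exact ⟨_, add_mem (W.smul_mem _ hθ) (W.smul_mem _ hω), hx.mul hy⟩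

/-- The chain rule for `f(η)`, modulo a subspace that contains the differentials of all the
derivatives that appear in `f`, except one. -/
lemma diffEval {σ : Type*} {η : σ → E} {s : Set (σ × ℕ)} {v : σ × ℕ} {U : Submodule E (ℕ → E)}
    {ω₀ : ℕ → E}
    (hs : ∀ w ∈ s, w ≠ v → ∃ ω ∈ U, HasDifferential F u (DiffAlg.iterDeriv w.2 (η w.1)) ω)
    (hv : HasDifferential F u (DiffAlg.iterDeriv v.2 (η v.1)) ω₀)
    {f : DiffPoly σ F} (hf : f ∈ supported F s) :
    ∃ ω ∈ U, HasDifferential F u (diffEval η f) (diffEval η (pderiv v f) • ω₀ + ω) := by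
  classical
  induction hf using Algebra.adjoin_induction with
  | mem x hx =>
    obtain ⟨w, hw, rfl⟩ := hx
    rw [diffEval_X, pderiv_X]
    by_cases h : w = v
    · subst h
      exact ⟨0, zero_mem _, by simpa using hv⟩
    · obtain ⟨ω, hω, hw⟩ := hs w hw h
      refine ⟨ω, hω, ?_⟩
      rwa [Pi.single_eq_of_ne h, map_zero, zero_smul, zero_add]
  | algebraMap c =>
    refine ⟨0, zero_mem _, ?_⟩
    rw [algebraMap_eq, pderiv_C, map_zero, zero_smul, zero_add, diffEval_C]
    exact algebraMap u c
  | add f g _ _ hf hg =>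
    obtain ⟨ω, hω, hf⟩ := hf
    obtain ⟨θ, hθ, hg⟩ := hg
    refine ⟨_, add_mem hω hθ, ?_⟩
    have := hf.add hg
    rw [map_add, map_add, map_add]
    convert this using 1
    module
  | mul f g _ _ hf hg =>
    obtain ⟨ω, hω, hf⟩ := hf
    obtain ⟨θ, hθ, hg⟩ := hg
    refine ⟨_, add_mem (U.smul_mem (DiffAlg.diffEval η f) hθ)
      (U.smul_mem (DiffAlg.diffEval η g) hω), ?_⟩
    have := hf.mul hg
    rw [Derivation.leibniz, smul_eq_mul, smul_eq_mul, map_add, map_mul, map_mul, map_mul]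
    convert this using 1
    module

end HasDifferential

end Differentials

/-! ### Leaders, saturation and divisibility by `A` -/

section Reduction

variable {σ F : Type*} [Field F]

lemma mem_supported_ordLE_of_isLeader {r : Ranking σ} {A : DiffPoly σ F} {i : σ} {n : ℕ}
    (h : IsLeader r A (i, n)) : A ∈ supported F (ordLE i n) := by
  rw [mem_supported]
  rintro ⟨j, k⟩ hv (rfl : j = i)
  change k ≤ n
  have := r.isStrictTotalOrder
  have hlt : ∀ d, r.lt (j, n) (j, n + d + 1) := by
    intro d
    induction d with
    | zero => exact r.lt_deriv _
    | succ d ih => exact trans_of r.lt ih (r.lt_deriv _)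
  by_contra hk
  obtain ⟨d, rfl⟩ : ∃ d, k = n + d + 1 := ⟨k - n - 1, by omega⟩
  have h1 := h.2 _ hv (by simp; omega)
  exact asymm_of r.lt h1 (hlt d)

lemma IsLeader.unique {r : Ranking σ} {A : DiffPoly σ F} {v w : σ × ℕ}
    (hv : IsLeader r A v) (hw : IsLeader r A w) : v = w := by
  have := r.isStrictTotalOrder
  by_contra h
  exact asymm_of r.lt (hv.2 w hw.1 (Ne.symm h)) (hw.2 v hv.1 h)

/-- No cancellation occurs: a monomial of top degree in `v` is determined by its part away from `v`.
-/
lemma initialAt_ne_zero {τ : Type*} {A : MvPolynomial (τ × ℕ) F} (hA : A ≠ 0) (v : τ × ℕ) :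
    initialAt A v ≠ 0 := by
  classical
  obtain ⟨m, hm, hmv⟩ : ∃ m ∈ A.support, m v = A.degreeOf v := by
    rw [degreeOf_eq_sup]
    obtain ⟨m, hm, h⟩ := Finset.exists_mem_eq_sup A.support (support_nonempty.2 hA) (fun m => m v)
    exact ⟨m, hm, h.symm⟩
  intro h0
  have h := congrArg (coeff (m.erase v)) h0
  rw [initialAt, coeff_sum, coeff_zero, Finset.sum_eq_single m] at h
  · rw [coeff_monomial, if_pos rfl] at h
    exact mem_support_iff.1 hm h
  · intro m' hm' hne
    rw [coeff_monomial, if_neg]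
    intro he
    refine hne ?_
    rw [← Finsupp.single_add_erase v m', ← Finsupp.single_add_erase v m, he, hmv,
      (Finset.mem_filter.1 hm').2]
  · intro h'
    exact absurd (Finset.mem_filter.2 ⟨hm, hmv⟩) h'

lemma degreeOf_initialAt (A : DiffPoly σ F) (v : σ × ℕ) : (initialAt A v).degreeOf v = 0 := by
  classical
  rw [← Nat.le_zero, initialAt]
  refine (degreeOf_sum_le _ _ _).trans (Finset.sup_le fun m hm => ?_)
  rw [degreeOf_le_iff]
  intro m' hm'
  rw [Finset.mem_singleton.1 (support_monomial_subset hm')]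
  simp

lemma degreeOf_pderiv_le {τ : Type*} (A : MvPolynomial τ F) (v : τ) :
    (pderiv v A).degreeOf v ≤ A.degreeOf v - 1 := by
  classical
  rw [degreeOf_le_iff]
  intro m hm
  rw [mem_support_iff, coeff_pderiv] at hm
  have h := (degreeOf_le_iff (n := v)).1 le_rfl _ (mem_support_iff.2 (left_ne_zero_of_mul hm))
  simp at h
  omega

lemma pderiv_ne_zero [CharZero F] {τ : Type*} {A : MvPolynomial τ F} {v : τ} (hv : v ∈ A.vars) :
    pderiv v A ≠ 0 := by
  classical
  obtain ⟨m, hm, hmv⟩ := (mem_vars_iff_mem_support v).1 hv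
  intro h0
  have h := congrArg (coeff (m - Finsupp.single v 1)) h0
  have hle : Finsupp.single v 1 ≤ m := by
    rw [Finsupp.single_le_iff]
    exact Nat.one_le_iff_ne_zero.2 (Finsupp.mem_support_iff.1 hmv)
  rw [coeff_pderiv, tsub_add_cancel_of_le hle, coeff_zero] at h
  rcases mul_eq_zero.1 h with h | h
  · exact mem_support_iff.1 hm h
  · exact Nat.cast_add_one_ne_zero _ h

lemma not_dvd_of_degreeOf_lt {τ : Type*} {A f : MvPolynomial τ F} (hf : f ≠ 0) {v : τ}
    (h : f.degreeOf v < A.degreeOf v) : ¬ A ∣ f := by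
  rintro ⟨B, rfl⟩
  rw [degreeOf_mul_eq (left_ne_zero_of_mul hf) (right_ne_zero_of_mul hf)] at h
  omega

lemma degreeOf_pos_iff {τ : Type*} {A : MvPolynomial τ F} {v : τ} :
    0 < A.degreeOf v ↔ v ∈ A.vars := by
  classical
  rw [degreeOf_def, Multiset.count_pos, vars_def, Multiset.mem_toFinset]

lemma aeval_congr_of_mem_supported {τ L : Type*} [CommRing L] [Algebra F L] {s : Set τ}
    {g g' : τ → L} (h : ∀ v ∈ s, g v = g' v) {f : MvPolynomial τ F} (hf : f ∈ supported F s) :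
    aeval g f = aeval g' f := by
  induction hf using Algebra.adjoin_induction with
  | mem x hx => obtain ⟨v, hv, rfl⟩ := hx; rw [aeval_X, aeval_X, h v hv]
  | algebraMap a => simp
  | add f g _ _ hf hg => rw [map_add, map_add, hf, hg]
  | mul f g _ _ hf hg => rw [map_mul, map_mul, hf, hg]

variable [Differential F]

/-- A point of `A` can be extended to the derivatives of `A`. -/
lemma exists_aeval_iterDeriv_eq_zero {L : Type*} [Field L] [Algebra F L] {A : DiffPoly σ F}
    {i : σ} {n : ℕ} (hA : A ∈ supported F (ordLE i n)) (x : σ × ℕ → L) (h0 : aeval x A = 0)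
    (hS : aeval x (pderiv (i, n) A) ≠ 0) (N : ℕ) :
    ∃ y : σ × ℕ → L, (∀ v ∈ ordLE i n, y v = x v) ∧ ∀ k ≤ N, aeval y (iterDeriv k A) = 0 := by
  classical
  induction N with
  | zero =>
    refine ⟨x, fun _ _ => rfl, fun k hk => ?_⟩
    rwa [Nat.le_zero.1 hk]
  | succ N ih =>
    obtain ⟨y, hy, hN⟩ := ih
    set S := pderiv (i, n) A
    have hSmem : S ∈ supported F (ordLE i n) := pderiv_mem_supported _ hA
    have hT := iterDeriv_succ_sub_mem_supported i n hA N
    set T := iterDeriv (N + 1) A - S * X (i, n + N + 1) with hTdef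
    have hdec : iterDeriv (N + 1) A = S * X (i, n + N + 1) + T := by rw [hTdef]; ring
    -- The next derivative of `A` is linear in a new variable with coefficient `S`. As `S` does not
    -- vanish at the point, the equation is solved for that variable.
    set y' := Function.update y (i, n + N + 1) (-aeval y T / aeval x S) with hy'
    have hyy' : ∀ v ∈ ordLE i (n + N), y' v = y v := by
      intro v hv
      rw [hy', Function.update_of_ne]
      rintro rfl
      have : n + N + 1 ≤ n + N := hv rfl
      omega
    have hyx : ∀ v ∈ ordLE i n, y' v = x v := fun v hv => by
      rw [hyy' v (ordLE_mono i (by omega) hv), hy v hv]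
    refine ⟨y', hyx, fun k hk => ?_⟩
    rcases Nat.le_succ_iff.1 hk with hk | rfl
    · rw [aeval_congr_of_mem_supported hyy'
        (supported_mono (ordLE_mono i (by omega)) (iterDeriv_mem_supported i n hA k))]
      exact hN k hk
    · rw [hdec, map_add, map_mul, aeval_X, aeval_congr_of_mem_supported hyx hSmem,
        aeval_congr_of_mem_supported hyy' hT, hy', Function.update_self, mul_div_cancel₀ _ hS,
        neg_add_cancel]

/-- An element of `[A]` involves only finitely many derivatives of `A`, so extending a point to
finitely many of them is enough. -/
lemma mem_span_iterDeriv_le {A g : DiffPoly σ F} (hg : g ∈ diffIdeal {A}) :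
    ∃ N, ∀ {L : Type _} [Field L] (φ : DiffPoly σ F →+* L),
      (∀ k ≤ N, φ (iterDeriv k A) = 0) → φ g = 0 := by
  induction hg using Submodule.span_induction with
  | mem g hg =>
    obtain ⟨f, rfl, k, rfl⟩ := hg
    exact ⟨k, fun φ h => h k le_rfl⟩
  | zero => exact ⟨0, fun φ _ => map_zero φ⟩
  | add f g _ _ hf hg =>
    obtain ⟨N, hN⟩ := hf
    obtain ⟨M, hM⟩ := hg
    refine ⟨max N M, fun φ h => ?_⟩
    rw [map_add, hN φ fun k hk => h k (hk.trans (le_max_left _ _)),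
      hM φ fun k hk => h k (hk.trans (le_max_right _ _)), add_zero]
  | smul a g _ hg =>
    obtain ⟨N, hN⟩ := hg
    exact ⟨N, fun φ h => by rw [smul_eq_mul, map_mul, hN φ h, mul_zero]⟩

/-- An element of `sat(A)` that contains no proper derivative of the leader is a multiple
of `A`. -/
lemma dvd_of_mem_sat [CharZero F] {r : Ranking σ} {A f : DiffPoly σ F} (hA : Irreducible A)
    {i : σ} {n : ℕ} (hl : IsLeader r A (i, n)) (hf : f ∈ sat r A)
    (hfn : f ∈ supported F (ordLE i n)) : A ∣ f := by
  obtain ⟨v, hv, m, hm⟩ := hf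
  obtain rfl := hl.unique hv
  have hAmem := mem_supported_ordLE_of_isLeader hl
  have hprime : Prime A := hA.prime
  have hdeg : 0 < A.degreeOf (i, n) := degreeOf_pos_iff.2 hl.1
  have hS : ¬ A ∣ separantAt A (i, n) :=
    not_dvd_of_degreeOf_lt (v := (i, n)) (pderiv_ne_zero hl.1) (by
      have := degreeOf_pderiv_le A (i, n)
      unfold separantAt
      omega)
  have hI : ¬ A ∣ initialAt A (i, n) :=
    not_dvd_of_degreeOf_lt (v := (i, n)) (initialAt_ne_zero hA.ne_zero _)
      (by rwa [degreeOf_initialAt])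
  have hIP : (Ideal.span {A}).IsPrime := (Ideal.span_singleton_prime hA.ne_zero).2 hprime
  -- `x` is the generic zero of `A` as an ordinary polynomial: what vanishes at `x` is exactly what
  -- `A` divides.
  let L := FractionRing (DiffPoly σ F ⧸ Ideal.span {A})
  let x : σ × ℕ → L := fun v => algebraMap (DiffPoly σ F ⧸ Ideal.span {A}) L
    (Ideal.Quotient.mk _ (X v))
  have hx : ∀ g : DiffPoly σ F, aeval x g = 0 ↔ A ∣ g := by
    intro g
    have : aeval x g = algebraMap (DiffPoly σ F ⧸ Ideal.span {A}) L (Ideal.Quotient.mk _ g) := by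
      have h2 : aeval x = ((IsScalarTower.toAlgHom F (DiffPoly σ F ⧸ Ideal.span {A}) L).comp
          (Ideal.Quotient.mkₐ F (Ideal.span {A}))) := by
        ext v
        simp [x]
      rw [h2]
      rfl
    rw [this, FaithfulSMul.algebraMap_eq_zero_iff, Ideal.Quotient.eq_zero_iff_mem,
      Ideal.mem_span_singleton]
  obtain ⟨N, hN⟩ := mem_span_iterDeriv_le hm
  obtain ⟨y, hyx, hy⟩ := exists_aeval_iterDeriv_eq_zero hAmem x ((hx A).2 dvd_rfl)
    (fun h => hS ((hx _).1 h)) N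
  have h := hN (aeval y).toRingHom hy
  have hImem : initialAt A (i, n) ∈ supported F (ordLE i n) := by
    classical
    unfold initialAt
    refine sum_mem fun m hm => ?_
    rw [mem_supported]
    intro v hv
    have hm' := Finset.mem_filter.1 hm
    rw [vars_monomial (mem_support_iff.1 hm'.1)] at hv
    refine mem_supported.1 hAmem ((mem_vars_iff_mem_support v).2 ⟨m, hm'.1, ?_⟩)
    rw [Finset.mem_coe, Finsupp.support_erase] at hv
    exact Finset.mem_of_mem_erase hv
  -- The point `y` kills the product because it lies in `[A]`. The product contains no proper
  -- derivative of the leader, and there `y` agrees with `x`.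
  have h' : aeval x ((separantAt A (i, n) * initialAt A (i, n)) ^ m * f) = 0 := by
    rw [← aeval_congr_of_mem_supported hyx]
    · exact h
    · exact mul_mem (pow_mem (mul_mem (pderiv_mem_supported _ hAmem) hImem) m) hfn
  rw [hx] at h'
  rcases hprime.dvd_or_dvd h' with h' | h'
  · rcases hprime.dvd_or_dvd (hprime.dvd_of_dvd_pow h') with h' | h'
    · exact absurd h' hS
    · exact absurd h' hI
  · exact h'

end Reduction

/-! ### Differential polynomials of degree at most one -/

section LinearPolynomials

variable {R : Type*} [CommRing R]

lemma coeff_eq_zero_of_totalDegree_lt_degree {τ : Type*} {P : MvPolynomial τ R} {n : τ →₀ ℕ}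
    (h : P.totalDegree < n.degree) : coeff n P = 0 :=
  coeff_eq_zero_of_totalDegree_lt h

lemma pderiv_of_totalDegree_le_one {τ : Type*} {P : MvPolynomial τ R} (h : P.totalDegree ≤ 1)
    (v : τ) : pderiv v P = C (coeff (Finsupp.single v 1) P) := by
  classical
  ext n
  rw [coeff_pderiv, coeff_C]
  split_ifs with hn
  · simp [← hn]
  · rw [coeff_eq_zero_of_totalDegree_lt_degree, zero_mul]
    rw [map_add, Finsupp.degree_single]
    have : n.degree ≠ 0 := fun h0 => hn ((Finsupp.degree_eq_zero_iff n).1 h0).symm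
    omega

lemma ord_le_iff {σ : Type*} {f : DiffPoly σ R} {m : ℕ} :
    ord f ≤ m ↔ ∀ v ∈ f.vars, v.2 ≤ m := by
  simp [ord, Finset.sup_le_iff]

lemma linearPart_eq_zero_of_ord_le {P : DiffPoly Unit R} {m : ℕ} (h : ord P ≤ m) {k : ℕ}
    (hk : m < k) : linearPart P k = 0 := by
  by_contra h0
  have := ord_le_iff.1 h ((), k)
    ((mem_vars_iff_mem_support _).2 ⟨_, mem_support_iff.2 h0, by simp⟩)
  exact absurd this (by simpa using hk)

lemma linearPart_ne_zero_of_mem_vars {P : DiffPoly Unit R} (h : P.totalDegree ≤ 1) {k : ℕ}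
    (hk : ((), k) ∈ P.vars) : linearPart P k ≠ 0 := by
  classical
  obtain ⟨n, hn, hnk⟩ := (mem_vars_iff_mem_support _).1 hk
  have hle : Finsupp.single ((), k) 1 ≤ n := by
    rw [Finsupp.single_le_iff]
    exact Nat.one_le_iff_ne_zero.2 (Finsupp.mem_support_iff.1 hnk)
  obtain ⟨d, rfl⟩ := exists_add_of_le hle
  have hd : d = 0 := by
    rw [← Finsupp.degree_eq_zero_iff]
    by_contra hd
    refine mem_support_iff.1 hn (coeff_eq_zero_of_totalDegree_lt_degree ?_)
    rw [map_add, Finsupp.degree_single]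
    omega
  rw [hd, add_zero] at hn
  exact mem_support_iff.1 hn

lemma eq_sum_of_totalDegree_le_one {P : DiffPoly Unit R} (h : P.totalDegree ≤ 1) {N : ℕ}
    (hN : ord P ≤ N) :
    P = ∑ k ∈ Finset.range (N + 1), C (linearPart P k) * X ((), k) + C (coeff 0 P) := by
  classical
  ext n
  simp only [coeff_add, coeff_sum, coeff_C_mul, coeff_X, coeff_C, mul_ite, mul_one, mul_zero]
  by_cases h0 : n = 0
  · subst h0
    simp
  rw [if_neg (Ne.symm h0), add_zero]
  by_cases h1 : n.degree = 1
  · obtain ⟨⟨⟨⟩, k⟩, rfl⟩ : ∃ v, n = Finsupp.single v 1 := by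
      obtain ⟨v, hv⟩ := Finsupp.support_nonempty_iff.2 h0
      have hle : Finsupp.single v 1 ≤ n := by
        rw [Finsupp.single_le_iff]
        exact Nat.one_le_iff_ne_zero.2 (Finsupp.mem_support_iff.1 hv)
      obtain ⟨d, rfl⟩ := exists_add_of_le hle
      rw [map_add, Finsupp.degree_single] at h1
      have : d = 0 := (Finsupp.degree_eq_zero_iff d).1 (by omega)
      exact ⟨v, by rw [this, add_zero]⟩
    simp only [Finsupp.single_left_inj one_ne_zero, Prod.mk.injEq, true_and]
    rw [Finset.sum_ite_eq' (Finset.range (N + 1)) k]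
    split_ifs with hk
    · rfl
    · exact linearPart_eq_zero_of_ord_le hN (by simpa using hk)
  · rw [coeff_eq_zero_of_totalDegree_lt_degree]
    · symm
      refine Finset.sum_eq_zero fun k _ => if_neg ?_
      rintro rfl
      exact h1 (Finsupp.degree_single _ _)
    · have : n.degree ≠ 0 := fun h' => h0 ((Finsupp.degree_eq_zero_iff n).1 h')
      omega

end LinearPolynomials

/-! ### The polynomials `z Q(u) - P(u)` and their derivatives -/

section ImplicitEquation

variable {F : Type*} [Field F]

lemma coeff_implicitEq (i : Fin 2) (P Q : DiffPoly Unit F) (n : Unit × ℕ →₀ ℕ) :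
    coeff n (implicitEq i P Q) = X (i, 0) * C (coeff n Q) - C (coeff n P) := by
  rw [implicitEq, coeff_sub, coeff_C_mul, coeff_map, coeff_map]

/-- As `z` is an indeterminate, `z Q` and `P` cannot cancel. This gives `z Q - P` the order of the
fraction, which fixes the size of the resultant matrix. -/
lemma coeff_implicitEq_eq_zero_iff (i : Fin 2) (P Q : DiffPoly Unit F) (n : Unit × ℕ →₀ ℕ) :
    coeff n (implicitEq i P Q) = 0 ↔ coeff n P = 0 ∧ coeff n Q = 0 := by
  classical
  rw [coeff_implicitEq]
  constructor
  · intro h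
    have h0 := congrArg (coeff 0) h
    have h1 := congrArg (coeff (Finsupp.single (i, 0) 1)) h
    rw [mul_comm, coeff_sub, coeff_C_mul, coeff_X, coeff_C] at h0 h1
    simp at h0 h1
    refine ⟨h0, ?_⟩
    rwa [h0, ite_self, sub_zero] at h1
  · rintro ⟨h1, h2⟩
    rw [h1, h2]
    simp

lemma ord_implicitEq (i : Fin 2) (P Q : DiffPoly Unit F) :
    ord (implicitEq i P Q) = ordFrac P Q := by
  classical
  have : (implicitEq i P Q).vars = P.vars ∪ Q.vars := by
    ext v
    simp only [mem_vars_iff_mem_support, Finset.mem_union, mem_support_iff, ne_eq,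
      coeff_implicitEq_eq_zero_iff, not_and_or, or_and_right, exists_or]
  rw [ord, this, Finset.sup_union]
  rfl

variable [Differential F]

/-- `(z Q - P)^(k)` is linear in `z^(k)`. -/
lemma coeff_iterDeriv_implicitEq_sub_mem (i : Fin 2) (P Q : DiffPoly Unit F) (k : ℕ)
    {n : Unit × ℕ →₀ ℕ} (hn : n = 0 ∨ ∃ l, n = Finsupp.single ((), l) 1) :
    coeff n (iterDeriv k (implicitEq i P Q)) - X (i, k) * C (coeff n Q) ∈
      supported F {w : Fin 2 × ℕ | w.1 = i ∧ w.2 < k} := by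
  induction k generalizing n with
  | zero =>
    rw [iterDeriv_zero, coeff_implicitEq, sub_sub_cancel_left]
    exact neg_mem (Subalgebra.algebraMap_mem _ _)
  | succ k ih =>
    have hX : (X (i, k) : DiffPoly (Fin 2) F) ∈
        supported F {w : Fin 2 × ℕ | w.1 = i ∧ w.2 < k + 1} :=
      Algebra.subset_adjoin ⟨_, ⟨rfl, k.lt_succ_self⟩, rfl⟩
    have hC : ∀ a : F, (C a : DiffPoly (Fin 2) F) ∈
        supported F {w : Fin 2 × ℕ | w.1 = i ∧ w.2 < k + 1} :=
      fun a => Subalgebra.algebraMap_mem _ a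
    have key : ∀ {n : Unit × ℕ →₀ ℕ}, (n = 0 ∨ ∃ l, n = Finsupp.single ((), l) 1) →
        Differential.deriv (coeff n (iterDeriv k (implicitEq i P Q))) -
          X (i, k + 1) * C (coeff n Q) ∈ supported F {w : Fin 2 × ℕ | w.1 = i ∧ w.2 < k + 1} := by
      intro n hn
      have h := deriv_mem_supported (t := {w : Fin 2 × ℕ | w.1 = i ∧ w.2 < k + 1})
        (fun w hw => ⟨hw.1, Nat.lt_succ_of_lt hw.2⟩) (fun w hw => ⟨hw.1, Nat.succ_lt_succ hw.2⟩)
        (ih hn)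
      rw [map_sub, Derivation.leibniz, deriv_X, deriv_C, smul_eq_mul, smul_eq_mul] at h
      have h2 := add_mem h (mul_mem hX (hC (Differential.deriv (coeff n Q))))
      convert h2 using 1
      ring
    rcases hn with rfl | ⟨l, rfl⟩
    · rw [iterDeriv_succ, ← constantCoeff_eq, constantCoeff_deriv, constantCoeff_eq]
      exact key (Or.inl rfl)
    · change linearPart (iterDeriv (k + 1) _) l - _ ∈ _
      rw [iterDeriv_succ, linearPart_deriv]
      cases l with
      | zero =>
        rw [shiftDeriv_apply_zero]
        exact key (Or.inr ⟨0, rfl⟩)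
      | succ l =>
        rw [shiftDeriv_apply_succ, add_sub_right_comm]
        refine add_mem (key (Or.inr ⟨_, rfl⟩)) ?_
        have := add_mem (supported_mono (t := {w : Fin 2 × ℕ | w.1 = i ∧ w.2 < k + 1})
          (fun w hw => ⟨hw.1, Nat.lt_succ_of_lt hw.2⟩) (ih (Or.inr ⟨l, rfl⟩)))
          (mul_mem hX (hC (coeff (Finsupp.single ((), l) 1) Q)))
        rwa [sub_add_cancel] at this

lemma coeff_iterDeriv_implicitEq_mem (i : Fin 2) (P Q : DiffPoly Unit F) (k : ℕ)
    {n : Unit × ℕ →₀ ℕ} (hn : n = 0 ∨ ∃ l, n = Finsupp.single ((), l) 1) :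
    coeff n (iterDeriv k (implicitEq i P Q)) ∈
      supported F {w : Fin 2 × ℕ | w.1 = i ∧ w.2 ≤ k} := by
  have h := add_mem (supported_mono (t := {w : Fin 2 × ℕ | w.1 = i ∧ w.2 ≤ k})
    (fun w hw => ⟨hw.1, hw.2.le⟩) (coeff_iterDeriv_implicitEq_sub_mem i P Q k hn))
    (mul_mem (show (X (i, k) : DiffPoly (Fin 2) F) ∈ supported F _ from
      Algebra.subset_adjoin ⟨(i, k), ⟨rfl, le_rfl⟩, rfl⟩)
      (Subalgebra.algebraMap_mem _ (coeff n Q)))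
  rwa [algebraMap_eq, sub_add_cancel] at h

end ImplicitEquation

/-! ### Determinants linear in one variable, and regularity -/

section Determinants

lemma det_mem_of_forall_mem {ι F A : Type*} [Fintype ι] [DecidableEq ι] [CommRing F] [CommRing A]
    [Algebra F A] {S : Subalgebra F A} {M : Matrix ι ι A} (h : ∀ a b, M a b ∈ S) : M.det ∈ S := by
  rw [Matrix.det_apply]
  refine sum_mem fun g _ => ?_
  rw [Units.smul_def]
  exact zsmul_mem (prod_mem fun a _ => h _ _) _

/-- A determinant with one row linear in the indeterminate `v`, the others free of it. -/
lemma det_sub_mem_supported {ι F τ : Type*} [Fintype ι] [DecidableEq ι] [CommRing F]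
    {s : Set τ} {M : Matrix ι ι (MvPolynomial τ F)} {a₀ : ι} {v : τ} {c : ι → F}
    (h₀ : ∀ b, M a₀ b - X v * C (c b) ∈ supported F s)
    (h : ∀ a, a ≠ a₀ → ∀ b, M a b ∈ supported F s) :
    (M.updateRow a₀ fun b => C (c b)).det ∈ supported F s ∧
      M.det - X v * (M.updateRow a₀ fun b => C (c b)).det ∈ supported F s := by
  have hdet : M.det = X v * (M.updateRow a₀ fun b => C (c b)).det +
      (M.updateRow a₀ fun b => M a₀ b - X v * C (c b)).det := by
    rw [← Matrix.det_updateRow_smul, ← Matrix.det_updateRow_add]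
    conv_lhs => rw [← Matrix.updateRow_eq_self M a₀]
    congr 2
    ext1 b
    simp
  rw [hdet, add_sub_cancel_left]
  constructor <;> refine det_mem_of_forall_mem fun a b => ?_ <;> by_cases ha : a = a₀
  · rw [ha, Matrix.updateRow_self]
    exact Subalgebra.algebraMap_mem _ _
  · rw [Matrix.updateRow_ne ha]
    exact h a ha b
  · rw [ha, Matrix.updateRow_self]
    exact h₀ b
  · rw [Matrix.updateRow_ne ha]
    exact h a ha b

lemma degreeOf_eq_zero_of_mem_supported {F τ : Type*} [CommRing F] {s : Set τ} {v : τ}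
    (hv : v ∉ s) {f : MvPolynomial τ F} (hf : f ∈ supported F s) : f.degreeOf v = 0 := by
  classical
  rw [degreeOf_def, Multiset.count_eq_zero]
  intro h
  exact hv (mem_supported.1 hf (by rw [vars_def]; simpa using h))

lemma degreeOf_le_one_of_sub_mem_supported {F τ : Type*} [CommRing F] [Nontrivial F] {s : Set τ}
    {v : τ} (hv : v ∉ s) {f g : MvPolynomial τ F} (hg : g ∈ supported F s)
    (hf : f - X v * g ∈ supported F s) : f.degreeOf v ≤ 1 := by
  rw [← sub_add_cancel f (X v * g)]
  refine (degreeOf_add_le _ _ _).trans (max_le ?_ ((degreeOf_mul_le _ _ _).trans ?_))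
  · rw [degreeOf_eq_zero_of_mem_supported hv hf]
    exact zero_le_one
  · rw [degreeOf_eq_zero_of_mem_supported hv hg, degreeOf_X_self]

lemma pderiv_eq_of_sub_mem_supported {F τ : Type*} [CommRing F] {s : Set τ} {v : τ}
    (hv : v ∉ s) {f g : MvPolynomial τ F} (hg : g ∈ supported F s)
    (hf : f - X v * g ∈ supported F s) : pderiv v f = g := by
  have h := pderiv_eq_zero_of_mem_supported hv hf
  rw [map_sub, Derivation.leibniz, pderiv_eq_zero_of_mem_supported hv hg, pderiv_X_self,
    smul_zero, zero_add, smul_eq_mul, mul_one, sub_eq_zero] at h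
  exact h

/-- Splits the rows of the resultant matrix into its two blocks, reversed so that `k` is the number
of derivations applied. -/
lemma sum_fin_eq_sum_add_sum {M : Type*} [AddCommMonoid M] (m₁ m₂ : ℕ) (g : ℕ → M) :
    ∑ a : Fin (m₁ + m₂ + 2), g a = ∑ k ∈ Finset.range (m₂ + 1), g (m₂ - k) +
      ∑ k ∈ Finset.range (m₁ + 1), g (m₁ + m₂ + 1 - k) := by
  rw [Fin.sum_univ_eq_sum_range, show m₁ + m₂ + 2 = (m₂ + 1) + (m₁ + 1) by omega,
    Finset.sum_range_add, ← Finset.sum_range_reflect g,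
    ← Finset.sum_range_reflect (fun x => g (m₂ + 1 + x))]
  congr 1
  refine Finset.sum_congr rfl fun k hk => congrArg g ?_
  have := Finset.mem_range.1 hk
  omega

variable {K : Type*} [Field K] [Differential K]

/-- Replacing in the differential resultant matrix one of the two rows of highest derivatives by
a row not orthogonal to the common kernel vector of all the rows gives a regular matrix. -/
lemma det_updateRow_ne_zero {m₁ m₂ : ℕ} {ω₁ ω₂ : ℕ → K}
    {M : Matrix (Fin (m₁ + m₂ + 2)) (Fin (m₁ + m₂ + 2)) K}
    (hM : ∀ a b : Fin (m₁ + m₂ + 2), (b : ℕ) ≤ m₁ + m₂ → M a b =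
      (if (a : ℕ) ≤ m₂ then shiftDeriv^[m₂ - a] ω₁ else shiftDeriv^[m₁ + m₂ + 1 - a] ω₂)
        (m₁ + m₂ - b))
    (hω₁ : ∀ k, m₁ < k → ω₁ k = 0) (hm₁ : ω₁ m₁ ≠ 0)
    (hω₂ : ∀ k, m₂ < k → ω₂ k = 0) (hm₂ : ω₂ m₂ ≠ 0)
    (h1 : (Pi.single 0 1 : ℕ → K) ∈ derivSpanTop ω₁ ⊔ derivSpanTop ω₂)
    {w : Fin (m₁ + m₂ + 2) → K} (hw : ∀ a, ∑ b, M a b * w b = 0)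
    {a₀ : Fin (m₁ + m₂ + 2)} (ha₀ : (a₀ : ℕ) = 0 ∨ (a₀ : ℕ) = m₂ + 1)
    {q : Fin (m₁ + m₂ + 2) → K} (hq : ∑ b, q b * w b ≠ 0) :
    (M.updateRow a₀ q).det ≠ 0 := by
  intro hdet
  obtain ⟨c, hc, hcM⟩ := Matrix.exists_vecMul_eq_zero_iff.2 hdet
  refine hc ?_
  -- Pairing the left kernel vector `c` with `w` annihilates every row except the new one.
  have hca₀ : c a₀ = 0 := by
    have h := congrArg (fun x => x ⬝ᵥ w) hcM
    simp only [← Matrix.dotProduct_mulVec, zero_dotProduct] at h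
    rw [dotProduct, Finset.sum_eq_single a₀] at h
    · refine (mul_eq_zero.1 h).resolve_right ?_
      simpa [Matrix.mulVec, dotProduct] using hq
    · intro a _ ha
      simp only [Matrix.mulVec, dotProduct, Matrix.updateRow_ne ha]
      rw [hw, mul_zero]
    · simp
  have hsum : ∀ b, ∑ a, c a * M a b = 0 := by
    intro b
    have h := congrFun hcM b
    simp only [Matrix.vecMul, dotProduct, Pi.zero_apply] at h
    rw [← h]
    refine Finset.sum_congr rfl fun a _ => ?_
    by_cases ha : a = a₀
    · rw [ha, hca₀, zero_mul, zero_mul]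
    · rw [Matrix.updateRow_ne ha]
  set c' : ℕ → K := fun a => if h : a < m₁ + m₂ + 2 then c ⟨a, h⟩ else 0 with hc'
  have hcc' : ∀ a : Fin (m₁ + m₂ + 2), c' a = c a := fun a => by simp [hc']
  -- The relation extends from the columns to whole operators, since no row has order above `m₁ +
  -- m₂`. The constant column is not needed.
  have hrows : ∑ a : Fin (m₁ + m₂ + 2), c' a • (if (a : ℕ) ≤ m₂ then shiftDeriv^[m₂ - a] ω₁
      else shiftDeriv^[m₁ + m₂ + 1 - a] ω₂) = 0 := by
    ext k
    rw [Finset.sum_apply, Pi.zero_apply]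
    by_cases hk : k ≤ m₁ + m₂
    · rw [← hsum ⟨m₁ + m₂ - k, by omega⟩]
      refine Finset.sum_congr rfl fun a _ => ?_
      rw [Pi.smul_apply, hcc', smul_eq_mul, hM _ _ (by simp),
        show m₁ + m₂ - (m₁ + m₂ - k) = k by omega]
    · refine Finset.sum_eq_zero fun a _ => ?_
      rw [Pi.smul_apply]
      split_ifs
      · rw [shiftDeriv_iterate_eq_zero hω₁ _ _ (by omega), smul_zero]
      · rw [shiftDeriv_iterate_eq_zero hω₂ _ _ (by omega), smul_zero]
  rw [sum_fin_eq_sum_add_sum m₁ m₂ fun a => c' a • (if a ≤ m₂ then shiftDeriv^[m₂ - a] ω₁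
      else shiftDeriv^[m₁ + m₂ + 1 - a] ω₂)] at hrows
  have e₁ : ∀ k ∈ Finset.range (m₂ + 1), c' (m₂ - k) • (if m₂ - k ≤ m₂ then
      shiftDeriv^[m₂ - (m₂ - k)] ω₁ else shiftDeriv^[m₁ + m₂ + 1 - (m₂ - k)] ω₂) =
      c' (m₂ - k) • shiftDeriv^[k] ω₁ := by
    intro k hk
    have := Finset.mem_range.1 hk
    rw [if_pos (by omega), show m₂ - (m₂ - k) = k by omega]
  have e₂ : ∀ k ∈ Finset.range (m₁ + 1), c' (m₁ + m₂ + 1 - k) • (if m₁ + m₂ + 1 - k ≤ m₂ then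
      shiftDeriv^[m₂ - (m₁ + m₂ + 1 - k)] ω₁ else
      shiftDeriv^[m₁ + m₂ + 1 - (m₁ + m₂ + 1 - k)] ω₂) =
      c' (m₁ + m₂ + 1 - k) • shiftDeriv^[k] ω₂ := by
    intro k hk
    have := Finset.mem_range.1 hk
    rw [if_neg (by omega), show m₁ + m₂ + 1 - (m₁ + m₂ + 1 - k) = k by omega]
  rw [Finset.sum_congr rfl e₁, Finset.sum_congr rfl e₂] at hrows
  -- Without row `a₀` one block is short: `m₂` multiples of `ω₁`, or `m₁` multiples of `ω₂`. That is
  -- the bound `t ≤ m` of the independence lemma, with the other operator as modulus.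
  have hall : (∀ k < m₂ + 1, c' (m₂ - k) = 0) ∧ ∀ k < m₁ + 1, c' (m₁ + m₂ + 1 - k) = 0 := by
    have hc0 := (hcc' a₀).trans hca₀
    rcases ha₀ with ha₀ | ha₀
    · rw [ha₀] at hc0
      rw [Finset.sum_range_succ, Nat.sub_self, hc0, zero_smul, add_zero, add_comm] at hrows
      obtain ⟨hb, ha⟩ := eq_zero_of_sum_add_sum_eq_zero hω₂ hm₂ (by rwa [sup_comm]) le_rfl hrows
      refine ⟨fun k hk => ?_, hb⟩
      rcases Nat.lt_succ_iff_lt_or_eq.1 hk with hk | rfl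
      · exact ha k hk
      · rwa [Nat.sub_self]
    · rw [ha₀] at hc0
      have e : m₁ + m₂ + 1 - m₁ = m₂ + 1 := by omega
      rw [Finset.sum_range_succ _ m₁, e, hc0, zero_smul, add_zero] at hrows
      obtain ⟨ha, hb⟩ := eq_zero_of_sum_add_sum_eq_zero hω₁ hm₁ h1 le_rfl hrows
      refine ⟨ha, fun k hk => ?_⟩
      rcases Nat.lt_succ_iff_lt_or_eq.1 hk with hk | rfl
      · exact hb k hk
      · rwa [e]
  ext a
  rw [← hcc', Pi.zero_apply]
  by_cases ha : (a : ℕ) ≤ m₂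
  · have := hall.1 (m₂ - a) (by omega)
    rwa [show m₂ - (m₂ - (a : ℕ)) = a by omega] at this
  · have := hall.2 (m₁ + m₂ + 1 - a) (by omega)
    rwa [show m₁ + m₂ + 1 - (m₁ + m₂ + 1 - (a : ℕ)) = a by omega] at this

/-- If `∑ ω k u^(k) + c` vanishes, then so do its derivatives. -/
lemma sum_shiftDeriv_iterate_eq_zero {ω : ℕ → K} {m N : ℕ} (hω : ∀ k, m < k → ω k = 0) (u c : K)
    (h : ∑ k ∈ Finset.range (N + 1), ω k * iterDeriv k u + c = 0) {j : ℕ} (hj : m + j ≤ N) :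
    ∑ k ∈ Finset.range (N + 1), (shiftDeriv^[j] ω) k * iterDeriv k u + iterDeriv j c = 0 := by
  induction j with
  | zero => exact h
  | succ j ih =>
    have ih := congrArg (⇑(Differential.deriv : Derivation ℤ K K)) (ih (by omega))
    rw [map_zero, map_add, map_sum, ← iterDeriv_succ] at ih
    rw [← ih, Function.iterate_succ_apply']
    congr 1
    set θ := shiftDeriv^[j] ω with hθ
    -- `θ` has order at most `m + j < N`, so differentiating produces no term in `u^(N+1)`.
    have h0 : θ N = 0 := shiftDeriv_iterate_eq_zero hω j N (by omega)
    simp only [Derivation.leibniz, smul_eq_mul, ← iterDeriv_succ, Finset.sum_add_distrib]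
    rw [Finset.sum_range_succ' (fun k => shiftDeriv θ k * iterDeriv k u),
      Finset.sum_range_succ (fun k => θ k * iterDeriv (k + 1) u), h0, zero_mul, add_zero,
      Finset.sum_range_succ' (fun k => iterDeriv k u * Differential.deriv (θ k)), ← add_assoc,
      ← Finset.sum_add_distrib, shiftDeriv_apply_zero, mul_comm (iterDeriv 0 u)]
    congr 1
    refine Finset.sum_congr rfl fun k _ => ?_
    rw [shiftDeriv_apply_succ]
    ring

end Determinants

/-! ### Operators attached to a linear parametrization -/

section LinearParametrization

variable {F E : Type*} [Field F] [Field E] [Algebra F E]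

/-- The linear part of `η Q - P`. -/
def operatorAt (η : E) (P Q : DiffPoly Unit F) : ℕ → E :=
  fun k => η * algebraMap F E (linearPart Q k) - algebraMap F E (linearPart P k)

lemma operatorAt_eq_zero (η : E) {P Q : DiffPoly Unit F} {m : ℕ} (hm : ordFrac P Q = m) (k : ℕ)
    (hk : m < k) : operatorAt η P Q k = 0 := by
  rw [operatorAt, linearPart_eq_zero_of_ord_le ((le_max_left _ _).trans hm.le) hk,
    linearPart_eq_zero_of_ord_le ((le_max_right _ _).trans hm.le) hk]
  simp

lemma ordFrac_mem_vars {P Q : DiffPoly Unit F} {m : ℕ} (hm : ordFrac P Q = m) :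
    ((), m) ∈ P.vars ∨ ((), m) ∈ Q.vars := by
  have key : ∀ f : DiffPoly Unit F, ord f = m → ((), m) ∈ f.vars := by
    intro f hf
    have hne : f.vars.Nonempty := by
      rw [Finset.nonempty_iff_ne_empty]
      intro h0
      rw [ord, h0, Finset.sup_empty] at hf
      exact WithBot.bot_ne_coe hf
    obtain ⟨v, hv, h⟩ := Finset.exists_mem_eq_sup f.vars hne fun v => (v.2 : WithBot ℕ)
    have : v = ((), m) := Prod.ext rfl (WithBot.coe_injective (h.symm.trans hf))
    rwa [← this]
  rcases max_choice (ord P) (ord Q) with h | h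
  · exact Or.inl (key P (h.symm.trans hm))
  · exact Or.inr (key Q (h.symm.trans hm))

variable [Differential E] {u : E} {P Q : DiffPoly Unit F} {m : ℕ}

lemma diffEval_eq_sum (h : P.totalDegree ≤ 1) {N : ℕ}
    (hN : ord P ≤ N) :
    diffEval (fun _ => u) P = ∑ k ∈ Finset.range (N + 1),
      algebraMap F E (linearPart P k) * iterDeriv k u + algebraMap F E (coeff 0 P) := by
  conv_lhs => rw [eq_sum_of_totalDegree_le_one h hN]
  simp only [map_add, map_sum, map_mul, diffEval_C, diffEval_X]

/-- If the top coefficient vanished, `P/Q` would be a constant of `F`. Coprimality would then make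
`Q` a unit, against its order. -/
lemma operatorAt_apply_top_ne_zero (hu : DiffTranscendental F u) (hQ0 : Q ≠ 0)
    (hred : IsRelPrime P Q) (hP : P.totalDegree ≤ 1) (hQ : Q.totalDegree ≤ 1)
    (hm : ordFrac P Q = m) :
    operatorAt (diffEval (fun _ => u) P / diffEval (fun _ => u) Q) P Q m ≠ 0 := by
  intro h
  rw [operatorAt, sub_eq_zero] at h
  have hQu : diffEval (fun _ => u) Q ≠ 0 := fun h0 => hQ0 (hu.injective (by rw [h0, map_zero]))
  have hvars := (ordFrac_mem_vars hm).imp (linearPart_ne_zero_of_mem_vars hP)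
    (linearPart_ne_zero_of_mem_vars hQ)
  have hq : linearPart Q m ≠ 0 := by
    intro hq
    rw [hq, map_zero, mul_zero, eq_comm, map_eq_zero] at h
    rcases hvars with h' | h'
    · exact h' h
    · exact h' hq
  have hPQ : P = C (linearPart P m / linearPart Q m) * Q := by
    refine hu.injective ?_
    rw [map_mul, diffEval_C, map_div₀, ← h, mul_div_cancel_right₀ _ (by simpa using hq),
      div_mul_cancel₀ _ hQu]
  have hunit : IsUnit Q := hred ⟨_, hPQ.trans (mul_comm _ _)⟩ dvd_rfl
  rw [isUnit_iff_eq_C_of_isReduced] at hunit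
  obtain ⟨c, -, rfl⟩ := hunit
  refine hq ?_
  classical
  rw [linearPart, coeff_C, if_neg]
  intro h0
  simpa using (DFunLike.congr_fun h0 ((), m)).symm

/-- For degree at most one the partial derivatives are constants, so the quotient rule produces the
operator itself. This links properness to the resultant matrix. -/
lemma hasDifferential_div (hP : P.totalDegree ≤ 1) (hQ : Q.totalDegree ≤ 1)
    (hQu : diffEval (fun _ => u) Q ≠ 0) :
    HasDifferential F u (diffEval (fun _ => u) P / diffEval (fun _ => u) Q)
      ((-(diffEval (fun _ => u) Q)⁻¹) •
        operatorAt (diffEval (fun _ => u) P / diffEval (fun _ => u) Q) P Q) := by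
  convert HasDifferential.div (p := P) hQu using 2
  ext k
  simp only [operatorAt, gradient, Pi.sub_apply, Pi.smul_apply, smul_eq_mul,
    pderiv_of_totalDegree_le_one hP, pderiv_of_totalDegree_le_one hQ, diffEval_C]
  rfl

/-- Pairing a coefficient row with `(u^(N), …, u, 1)` evaluates the corresponding linear polynomial
at `u`. -/
lemma sum_fin_mul_eq_sum_range (φ : (Unit × ℕ →₀ ℕ) → E) (u : E) (N : ℕ) :
    ∑ b : Fin (N + 2), φ (if (b : ℕ) ≤ N then Finsupp.single ((), N - (b : ℕ)) 1 else 0) *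
      (if (b : ℕ) ≤ N then iterDeriv (N - (b : ℕ)) u else 1) =
    ∑ k ∈ Finset.range (N + 1), φ (Finsupp.single ((), k) 1) * iterDeriv k u + φ 0 := by
  rw [Fin.sum_univ_eq_sum_range (fun b => φ (if b ≤ N then Finsupp.single ((), N - b) 1 else 0) *
      (if b ≤ N then iterDeriv (N - b) u else 1)) (N + 2), Finset.sum_range_succ,
    ← Finset.sum_range_reflect]
  simp only [Nat.not_succ_le_self, if_false, mul_one]
  congr 1
  refine Finset.sum_congr rfl fun k hk => ?_
  have := Finset.mem_range.1 hk
  rw [if_pos (by omega), if_pos (by omega), show N - (N + 1 - 1 - k) = k by omega]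

variable [Differential F] [DifferentialAlgebra F E]

lemma diffEval_coeff_iterDeriv (η : Fin 2 → E) (i : Fin 2) (P Q : DiffPoly Unit F) (j k : ℕ) :
    diffEval η (coeff (Finsupp.single ((), k) 1) (iterDeriv j (implicitEq i P Q))) =
      (shiftDeriv^[j] (operatorAt (η i) P Q)) k := by
  have h : ((diffEval η : DiffPoly (Fin 2) F →ₐ[F] E) : DiffPoly (Fin 2) F →+* E) ∘
      linearPart (implicitEq i P Q) =
      operatorAt (η i) P Q := by
    ext k
    simp [operatorAt, linearPart, coeff_implicitEq, diffEval_X, iterDeriv_zero]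
  have h' := comp_shiftDeriv_iterate ((diffEval η : DiffPoly (Fin 2) F →ₐ[F] E) :
    DiffPoly (Fin 2) F →+* E) (diffEval_deriv η) j (linearPart (implicitEq i P Q))
  rw [h, ← linearPart_iterDeriv] at h'
  exact congrFun h' k

lemma sum_diffEval_coeff_iterDeriv {η : Fin 2 → E} {i : Fin 2} (hP : P.totalDegree ≤ 1)
    (hQ : Q.totalDegree ≤ 1) (hm : ordFrac P Q = m)
    (hη : η i * diffEval (fun _ => u) Q = diffEval (fun _ => u) P) {j N : ℕ} (hj : m + j ≤ N) :
    ∑ b : Fin (N + 2), diffEval η (coeff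
      (if (b : ℕ) ≤ N then Finsupp.single ((), N - (b : ℕ)) 1 else 0)
      (iterDeriv j (implicitEq i P Q))) *
      (if (b : ℕ) ≤ N then iterDeriv (N - (b : ℕ)) u else 1) = 0 := by
  rw [sum_fin_mul_eq_sum_range fun n => diffEval η (coeff n (iterDeriv j (implicitEq i P Q)))]
  simp only [diffEval_coeff_iterDeriv]
  rw [coeff_zero_iterDeriv, show diffEval η (iterDeriv j (coeff 0 (implicitEq i P Q))) =
    iterDeriv j (diffEval η (coeff 0 (implicitEq i P Q))) from
      map_iterDeriv ((diffEval η : DiffPoly (Fin 2) F →ₐ[F] E) : DiffPoly (Fin 2) F →+* E)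
        (diffEval_deriv η) j _]
  refine sum_shiftDeriv_iterate_eq_zero (operatorAt_eq_zero (η i) hm) u _ ?_ hj
  have hmN : (m : WithBot ℕ) ≤ N := by exact_mod_cast (by omega : m ≤ N)
  rw [diffEval_eq_sum hP (((le_max_left _ _).trans hm.le).trans hmN),
    diffEval_eq_sum hQ (((le_max_right _ _).trans hm.le).trans hmN)] at hη
  simp only [operatorAt, sub_mul, Finset.sum_sub_distrib, mul_assoc, ← Finset.mul_sum]
  rw [coeff_implicitEq, map_sub, map_mul, diffEval_X, diffEval_C, diffEval_C]
  simp only [iterDeriv_zero]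
  linear_combination hη

end LinearParametrization

/-! ### The differential resultant at the point -/

section Resultant

variable {F E : Type*} [Field F] [Differential F] [Field E] [Differential E] [Algebra F E]

/-- The data of a proper linear parametrization that determine the differential resultant. -/
structure IsProperLinear (u : E) (η : Fin 2 → E) (P Q : Fin 2 → DiffPoly Unit F)
    (m₁ m₂ : ℕ) : Prop where
  totalDegree_num : ∀ i, (P i).totalDegree ≤ 1
  totalDegree_den : ∀ i, (Q i).totalDegree ≤ 1
  den_ne_zero : ∀ i, diffEval (fun _ => u) (Q i) ≠ 0
  point : ∀ i, η i * diffEval (fun _ => u) (Q i) = diffEval (fun _ => u) (P i)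
  ordFrac₁ : ordFrac (P 0) (Q 0) = m₁
  ordFrac₂ : ordFrac (P 1) (Q 1) = m₂
  top_ne_zero₁ : operatorAt (η 0) (P 0) (Q 0) m₁ ≠ 0
  top_ne_zero₂ : operatorAt (η 1) (P 1) (Q 1) m₂ ≠ 0
  unit_mem : (Pi.single 0 1 : ℕ → E) ∈ derivSpanTop (operatorAt (η 0) (P 0) (Q 0)) ⊔
    derivSpanTop (operatorAt (η 1) (P 1) (Q 1))

namespace IsProperLinear

variable {u : E} {η : Fin 2 → E} {P Q : Fin 2 → DiffPoly Unit F} {m₁ m₂ : ℕ}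

lemma diffRes_eq (h : IsProperLinear u η P Q m₁ m₂) :
    diffRes (implicitEq 0 (P 0) (Q 0)) (implicitEq 1 (P 1) (Q 1)) =
      (diffResMatrix m₁ m₂ (implicitEq 0 (P 0) (Q 0)) (implicitEq 1 (P 1) (Q 1))).det := by
  rw [diffRes, ord_implicitEq, ord_implicitEq, h.ordFrac₁, h.ordFrac₂]
  rfl

lemma diffRes_mem_supported (h : IsProperLinear u η P Q m₁ m₂) :
    diffRes (implicitEq 0 (P 0) (Q 0)) (implicitEq 1 (P 1) (Q 1)) ∈
      supported F {w : Fin 2 × ℕ | w.2 ≤ ![m₂, m₁] w.1} := by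
  rw [h.diffRes_eq]
  refine det_mem_of_forall_mem fun a b => ?_
  have hμ : ∀ n : ℕ, (if n ≤ m₁ + m₂ then Finsupp.single ((), m₁ + m₂ - n) 1 else 0) = 0 ∨
      ∃ l, (if n ≤ m₁ + m₂ then Finsupp.single ((), m₁ + m₂ - n) 1 else 0) =
        Finsupp.single ((), l) 1 := by
    intro n
    split_ifs
    · exact Or.inr ⟨_, rfl⟩
    · exact Or.inl rfl
  simp only [diffResMatrix, Matrix.of_apply]
  by_cases ha : (a : ℕ) ≤ m₂
  · rw [if_pos ha]
    refine supported_mono ?_ (coeff_iterDeriv_implicitEq_mem 0 _ _ _ (hμ b))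
    rintro ⟨j, k⟩ ⟨rfl : j = 0, hk : k ≤ m₂ - a⟩
    change k ≤ m₂
    omega
  · rw [if_neg ha]
    refine supported_mono ?_ (coeff_iterDeriv_implicitEq_mem 1 _ _ _ (hμ b))
    rintro ⟨j, k⟩ ⟨rfl : j = 1, hk : k ≤ m₁ + m₂ + 1 - a⟩
    change k ≤ m₁
    omega

variable [DifferentialAlgebra F E]

lemma sum_diffResMatrix_mul (h : IsProperLinear u η P Q m₁ m₂) (a : Fin (m₁ + m₂ + 2)) :
    ∑ b, diffEval η
      (diffResMatrix m₁ m₂ (implicitEq 0 (P 0) (Q 0)) (implicitEq 1 (P 1) (Q 1)) a b) *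
      (if (b : ℕ) ≤ m₁ + m₂ then iterDeriv (m₁ + m₂ - (b : ℕ)) u else 1) = 0 := by
  simp only [diffResMatrix, Matrix.of_apply]
  split_ifs with ha
  · exact sum_diffEval_coeff_iterDeriv (h.totalDegree_num 0) (h.totalDegree_den 0) h.ordFrac₁
      (h.point 0) (by omega)
  · exact sum_diffEval_coeff_iterDeriv (h.totalDegree_num 1) (h.totalDegree_den 1) h.ordFrac₂
      (h.point 1) (by omega)

lemma diffEval_diffRes (h : IsProperLinear u η P Q m₁ m₂) :
    diffEval η (diffRes (implicitEq 0 (P 0) (Q 0)) (implicitEq 1 (P 1) (Q 1))) = 0 := by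
  rw [h.diffRes_eq, AlgHom.map_det, ← Matrix.exists_mulVec_eq_zero_iff]
  refine ⟨_, fun h0 => ?_, funext h.sum_diffResMatrix_mul⟩
  -- The kernel vector is nonzero because its last entry is `1`.
  simpa using congrFun h0 (Fin.last _)

/-- The differential resultant is linear in `x^(m₂)` and in `y^(m₁)`, and the coefficients do not
vanish at the point. -/
lemma diffRes_linear (h : IsProperLinear u η P Q m₁ m₂) (i : Fin 2) :
    (diffRes (implicitEq 0 (P 0) (Q 0)) (implicitEq 1 (P 1) (Q 1))).degreeOf
        (i, ![m₂, m₁] i) ≤ 1 ∧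
      diffEval η (pderiv (i, ![m₂, m₁] i)
        (diffRes (implicitEq 0 (P 0) (Q 0)) (implicitEq 1 (P 1) (Q 1)))) ≠ 0 := by
  rw [h.diffRes_eq]
  set M := diffResMatrix m₁ m₂ (implicitEq 0 (P 0) (Q 0)) (implicitEq 1 (P 1) (Q 1)) with hMdef
  set μ : Fin (m₁ + m₂ + 2) → (Unit × ℕ →₀ ℕ) := fun b =>
    if (b : ℕ) ≤ m₁ + m₂ then Finsupp.single ((), m₁ + m₂ - (b : ℕ)) 1 else 0 with hμdef
  have hμ : ∀ b, μ b = 0 ∨ ∃ l, μ b = Finsupp.single ((), l) 1 := by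
    intro b
    simp only [hμdef]
    split_ifs
    · exact Or.inr ⟨_, rfl⟩
    · exact Or.inl rfl
  have hM₁ : ∀ a b : Fin (m₁ + m₂ + 2), (a : ℕ) ≤ m₂ →
      M a b = coeff (μ b) (iterDeriv (m₂ - a) (implicitEq 0 (P 0) (Q 0))) := fun a b ha => by
    simp only [hMdef, diffResMatrix, Matrix.of_apply, if_pos ha, hμdef]
  have hM₂ : ∀ a b : Fin (m₁ + m₂ + 2), ¬ (a : ℕ) ≤ m₂ →
      M a b = coeff (μ b) (iterDeriv (m₁ + m₂ + 1 - a) (implicitEq 1 (P 1) (Q 1))) :=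
    fun a b ha => by
      simp only [hMdef, diffResMatrix, Matrix.of_apply, if_neg ha, hμdef]
  set s : Set (Fin 2 × ℕ) := {w | w.2 ≤ ![m₂, m₁] w.1 ∧ w ≠ (i, ![m₂, m₁] i)} with hs
  have hvs : (i, ![m₂, m₁] i) ∉ s := fun h' => h'.2 rfl
  -- `a₀` is the row of `f₁^(m₂)` for `i = 0` and of `f₂^(m₁)` for `i = 1`, the only row that can
  -- contain the variable in question.
  obtain ⟨a₀, ha₀, h₀, hne⟩ : ∃ a₀ : Fin (m₁ + m₂ + 2),
      ((a₀ : ℕ) = 0 ∨ (a₀ : ℕ) = m₂ + 1) ∧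
      (∀ b, M a₀ b - X (i, ![m₂, m₁] i) * C (coeff (μ b) (Q i)) ∈ supported F s) ∧
      ∀ a, a ≠ a₀ → ∀ b, M a b ∈ supported F s := by
    have hsub₁ : ∀ a : Fin (m₁ + m₂ + 2), (a : ℕ) ≤ m₂ → (i = 0 → (a : ℕ) ≠ 0) →
        ∀ b, M a b ∈ supported F s := by
      intro a ha hia b
      rw [hM₁ a b ha]
      refine supported_mono ?_ (coeff_iterDeriv_implicitEq_mem 0 _ _ _ (hμ b))
      rintro ⟨j, k⟩ ⟨rfl : j = 0, hk : k ≤ m₂ - a⟩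
      refine ⟨show k ≤ m₂ by omega, fun he => ?_⟩
      obtain ⟨h0, hk0⟩ := Prod.mk.inj he
      subst h0
      have hk0 : k = m₂ := hk0
      have := hia rfl
      omega
    have hsub₂ : ∀ a : Fin (m₁ + m₂ + 2), ¬ (a : ℕ) ≤ m₂ → (i = 1 → (a : ℕ) ≠ m₂ + 1) →
        ∀ b, M a b ∈ supported F s := by
      intro a ha hia b
      rw [hM₂ a b ha]
      refine supported_mono ?_ (coeff_iterDeriv_implicitEq_mem 1 _ _ _ (hμ b))
      rintro ⟨j, k⟩ ⟨rfl : j = 1, hk : k ≤ m₁ + m₂ + 1 - a⟩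
      refine ⟨show k ≤ m₁ by omega, fun he => ?_⟩
      obtain ⟨h0, hk0⟩ := Prod.mk.inj he
      subst h0
      have hk0 : k = m₁ := hk0
      have := hia rfl
      omega
    obtain rfl | rfl : i = 0 ∨ i = 1 := by fin_cases i <;> simp
    · refine ⟨0, Or.inl rfl, fun b => ?_, fun a ha b => ?_⟩
      · rw [hM₁ 0 b (Nat.zero_le _)]
        refine supported_mono ?_ (coeff_iterDeriv_implicitEq_sub_mem 0 _ _ m₂ (hμ b))
        rintro ⟨j, k⟩ ⟨rfl : j = 0, hk : k < m₂⟩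
        exact ⟨hk.le, fun he => hk.ne (Prod.mk.inj he).2⟩
      · by_cases ha' : (a : ℕ) ≤ m₂
        · exact hsub₁ a ha' (fun _ h0 => ha (Fin.ext h0)) b
        · exact hsub₂ a ha' (by simp) b
    · refine ⟨⟨m₂ + 1, by omega⟩, Or.inr rfl, fun b => ?_, fun a ha b => ?_⟩
      · rw [hM₂ _ b (by simp), show m₁ + m₂ + 1 - (m₂ + 1) = m₁ by omega]
        refine supported_mono ?_ (coeff_iterDeriv_implicitEq_sub_mem 1 _ _ m₁ (hμ b))
        rintro ⟨j, k⟩ ⟨rfl : j = 1, hk : k < m₁⟩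
        exact ⟨hk.le, fun he => hk.ne (Prod.mk.inj he).2⟩
      · by_cases ha' : (a : ℕ) ≤ m₂
        · exact hsub₁ a ha' (by simp) b
        · exact hsub₂ a ha' (fun _ h0 => ha (Fin.ext h0)) b
  obtain ⟨hS, hT⟩ := det_sub_mem_supported (c := fun b => coeff (μ b) (Q i)) h₀ hne
  refine ⟨degreeOf_le_one_of_sub_mem_supported hvs hS hT, ?_⟩
  rw [pderiv_eq_of_sub_mem_supported hvs hS hT, AlgHom.map_det]
  have hmap : (diffEval η).mapMatrix (M.updateRow a₀ fun b => C (coeff (μ b) (Q i))) =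
      ((diffEval η).mapMatrix M).updateRow a₀ fun b => algebraMap F E (coeff (μ b) (Q i)) := by
    ext a b
    by_cases ha : a = a₀
    · simp [ha]
    · simp [ha]
  rw [hmap]
  refine det_updateRow_ne_zero (ω₁ := operatorAt (η 0) (P 0) (Q 0))
    (ω₂ := operatorAt (η 1) (P 1) (Q 1)) ?_ (operatorAt_eq_zero _ h.ordFrac₁) h.top_ne_zero₁
    (operatorAt_eq_zero _ h.ordFrac₂) h.top_ne_zero₂ h.unit_mem h.sum_diffResMatrix_mul ha₀ ?_
  · intro a b hb
    have hμb : μ b = Finsupp.single ((), m₁ + m₂ - (b : ℕ)) 1 := by simp only [hμdef, if_pos hb]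
    change diffEval η (M a b) = _
    by_cases ha : (a : ℕ) ≤ m₂
    · rw [if_pos ha, hM₁ a b ha, hμb, diffEval_coeff_iterDeriv]
    · rw [if_neg ha, hM₂ a b ha, hμb, diffEval_coeff_iterDeriv]
  -- The replacement row pairs with the kernel vector to `Qᵢ(u)`, which is nonzero.
  · rw [sum_fin_mul_eq_sum_range fun n => algebraMap F E (coeff n (Q i))]
    refine ne_of_eq_of_ne ?_ (h.den_ne_zero i)
    refine (diffEval_eq_sum (h.totalDegree_den i) ?_).symm
    have hle : ∀ j, ord (Q j) ≤ ordFrac (P j) (Q j) := fun j => le_max_right _ _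
    obtain rfl | rfl : i = 0 ∨ i = 1 := by fin_cases i <;> simp
    · refine (hle 0).trans (h.ordFrac₁.le.trans ?_)
      exact_mod_cast Nat.le_add_right _ _
    · refine (hle 1).trans (h.ordFrac₂.le.trans ?_)
      exact_mod_cast Nat.le_add_left _ _

/-- The order in `x` or `y` of an equation `A` of the point that is regular at the point is at
least `m₂` or `m₁` respectively. -/
lemma le_of_diffEval_eq_zero (h : IsProperLinear u η P Q m₁ m₂) (hu : DiffTranscendental F u)
    {A : DiffPoly (Fin 2) F} {i : Fin 2} {n : ℕ} (hA : A ∈ supported F (ordLE i n))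
    (h0 : diffEval η A = 0) (hS : diffEval η (pderiv (i, n) A) ≠ 0) : ![m₂, m₁] i ≤ n := by
  by_contra! hn
  set ω : Fin 2 → ℕ → E := fun j => operatorAt (η j) (P j) (Q j) with hω
  -- In `Fin 2`, `1 - i` is the other index. `U` contains the differentials of all derivatives of
  -- the other coordinate and of those of `η i` of order below `n`.
  set U := derivSpanTop (ω (1 - i)) ⊔ derivSpan (ω i) n with hU
  have hnot : shiftDeriv^[n] (ω i) ∉ U := by
    obtain rfl | rfl : i = 0 ∨ i = 1 := by fin_cases i <;> simp
    · exact iterate_notMem_sup (operatorAt_eq_zero _ h.ordFrac₂) h.top_ne_zero₂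
        (by rw [sup_comm]; exact h.unit_mem) hn
    · exact iterate_notMem_sup (operatorAt_eq_zero _ h.ordFrac₁) h.top_ne_zero₁ h.unit_mem hn
  have hd : ∀ j, HasDifferential F u (η j) (-(diffEval (fun _ => u) (Q j))⁻¹ • ω j) := by
    intro j
    have := hasDifferential_div (h.totalDegree_num j) (h.totalDegree_den j) (h.den_ne_zero j)
    rwa [← eq_div_of_mul_eq (h.den_ne_zero j) (h.point j)] at this
  obtain ⟨θ, hθ, hθd⟩ := (hd i).iterDeriv n
  obtain ⟨ξ, hξ, hξd⟩ := HasDifferential.diffEval (U := U) (v := (i, n)) (s := ordLE i n)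
    (fun w hw hwn => by
      obtain ⟨j, k⟩ := w
      obtain ⟨ω', hω', hd'⟩ := (hd j).iterDeriv' k
      refine ⟨ω', ?_, hd'⟩
      by_cases hj : j = i
      · subst hj
        have h1 : k ≤ n := hw rfl
        have h2 : k ≠ n := fun hk => hwn (by rw [hk])
        exact Submodule.mem_sup_right (derivSpan_mono _ (by omega) hω')
      · have : j = 1 - i := by omega
        subst this
        exact Submodule.mem_sup_left (derivSpan_le_top _ _ hω')) hθd hA
  rw [h0] at hξd
  -- The differential of `A(η) = 0` is zero, so a nonzero multiple of `∂^n ωᵢ` lies in `U`.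
  have hzero := hξd.eq_zero hu
  rw [smul_add, smul_smul, add_assoc] at hzero
  have hc : diffEval η (pderiv (i, n) A) * -(diffEval (fun _ => u) (Q i))⁻¹ ≠ 0 :=
    mul_ne_zero hS (neg_ne_zero.2 (inv_ne_zero (h.den_ne_zero i)))
  refine hnot ?_
  rw [← inv_smul_smul₀ hc (shiftDeriv^[n] (ω i)), eq_neg_of_add_eq_zero_left hzero]
  exact U.smul_mem _ (neg_mem (add_mem (U.smul_mem _ (Submodule.mem_sup_right hθ)) hξ))

end IsProperLinear

/-- Otherwise `H_A` would lie in `sat(A)`, so a power of it would lie in `[A]`. That puts `1` in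
`sat(A)`, which has a zero. -/
lemma IsLeader.diffEval_separantAt_ne_zero {σ : Type*} {r : Ranking σ} {A : DiffPoly σ F}
    {η : σ → E} {v : σ × ℕ} (hv : IsLeader r A v) (hgen : IsGenericPoint η (sat r A)) :
    diffEval η (separantAt A v) ≠ 0 := by
  intro h0
  have hmem : separantAt A v * initialAt A v ∈ sat r A := by
    rw [← hgen]
    change diffEval η _ = 0
    rw [map_mul, h0, zero_mul]
  obtain ⟨w, hw, k, hk⟩ := hmem
  obtain rfl := hw.unique hv
  have h1 : (1 : DiffPoly σ F) ∈ sat r A := ⟨w, hw, k + 1, by rwa [mul_one, pow_succ]⟩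
  rw [← hgen] at h1
  have h1 : diffEval η (1 : DiffPoly σ F) = 0 := h1
  rw [map_one] at h1
  exact one_ne_zero h1

variable [DifferentialAlgebra F E] {u : E} {P Q : Fin 2 → DiffPoly Unit F} {m₁ m₂ : ℕ}

lemma IsDiffRatParam.isProperLinear {r : Ranking (Fin 2)} {A : DiffPoly (Fin 2) F}
    (hparam : IsDiffRatParam r A u P Q) (hlinear : IsLinearParam P Q)
    (hm₁ : ordFrac (P 0) (Q 0) = m₁) (hm₂ : ordFrac (P 1) (Q 1) = m₂)
    (hproper : IsProperParam u P Q) : IsProperLinear u (paramPoint u P Q) P Q m₁ m₂ := by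
  have hu := hparam.transcendental
  have hQ : ∀ i, diffEval (fun _ => u) (Q i) ≠ 0 := fun i h0 =>
    hparam.den_ne_zero i (hu.injective (by rw [h0, map_zero]))
  refine ⟨fun i => (hlinear i).1, fun i => (hlinear i).2, hQ, fun i => div_mul_cancel₀ _ (hQ i),
    hm₁, hm₂, operatorAt_apply_top_ne_zero hu (hparam.den_ne_zero 0) (hparam.reduced 0)
      (hlinear 0).1 (hlinear 0).2 hm₁,
    operatorAt_apply_top_ne_zero hu (hparam.den_ne_zero 1) (hparam.reduced 1)
      (hlinear 1).1 (hlinear 1).2 hm₂, ?_⟩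
  have hmem : u ∈ diffAdjoin F (Set.range (paramPoint u P Q)) := by
    rw [hproper]
    exact IntermediateField.subset_adjoin _ _ ⟨u, rfl, 0, rfl⟩
  obtain ⟨ω, hω, hd⟩ := HasDifferential.of_mem_diffAdjoin (u := u)
    (W := derivSpanTop (operatorAt (paramPoint u P Q 0) (P 0) (Q 0)) ⊔
      derivSpanTop (operatorAt (paramPoint u P Q 1) (P 1) (Q 1))) (fun s hs k => by
    obtain ⟨i, rfl⟩ := hs
    obtain ⟨θ, hθ, h⟩ := (hasDifferential_div (hlinear i).1 (hlinear i).2 (hQ i)).iterDeriv' k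
    refine ⟨θ, ?_, h⟩
    have hθ' := derivSpan_le_top _ _ hθ
    obtain rfl | rfl : i = 0 ∨ i = 1 := by fin_cases i <;> simp
    · exact Submodule.mem_sup_left hθ'
    · exact Submodule.mem_sup_right hθ') hmem
  rwa [← hd.eq_single hu]

end Resultant

end DiffAlg

end

/-! ### The main theorem -/

theorem mainTheorem9 {F E : Type*} [Field F] [CharZero F] [Differential F]
    [Field E] [Differential E] [Algebra F E] [DifferentialAlgebra F E]
    (r : DiffAlg.Ranking (Fin 2)) (A : DiffAlg.DiffPoly (Fin 2) F) (u : E)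
    (P Q : Fin 2 → DiffAlg.DiffPoly Unit F) (m₁ m₂ : ℕ)
    (hparam : DiffAlg.IsDiffRatParam r A u P Q)
    (hlinear : DiffAlg.IsLinearParam P Q)
    (hm₁ : DiffAlg.ordFrac (P 0) (Q 0) = m₁)
    (hm₂ : DiffAlg.ordFrac (P 1) (Q 1) = m₂)
    (hproper : DiffAlg.IsProperParam u P Q) :
    DiffAlg.IsMainIrreducibleFactor A
        (DiffAlg.diffRes (DiffAlg.implicitEq 0 (P 0) (Q 0))
          (DiffAlg.implicitEq 1 (P 1) (Q 1))) ∧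
      A.degreeOf (0, m₂) = 1 ∧ A.degreeOf (1, m₁) = 1 := by
  classical
  have h := hparam.isProperLinear hlinear hm₁ hm₂ hproper
  have hgen := hparam.generic
  set η := DiffAlg.paramPoint u P Q
  have hRsupp := h.diffRes_mem_supported
  have hRlin := h.diffRes_linear
  have hReval := h.diffEval_diffRes
  set R := DiffAlg.diffRes (DiffAlg.implicitEq 0 (P 0) (Q 0)) (DiffAlg.implicitEq 1 (P 1) (Q 1))
  have hRsat : R ∈ DiffAlg.sat r A := by
    rw [← hgen]
    exact hReval
  -- Membership in `sat(A)` carries a leader of `A`.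
  obtain ⟨⟨i, n⟩, hl, -⟩ := id hRsat
  have hAeval : DiffAlg.diffEval η A = 0 := by
    have : A ∈ DiffAlg.sat r A :=
      ⟨_, hl, 0, by rw [pow_zero, one_mul]; exact Ideal.subset_span ⟨A, rfl, 0, rfl⟩⟩
    rw [← hgen] at this
    exact this
  have hmn := h.le_of_diffEval_eq_zero hparam.transcendental
    (DiffAlg.mem_supported_ordLE_of_isLeader hl) hAeval (hl.diffEval_separantAt_ne_zero hgen)
  have hdvd : A ∣ R := DiffAlg.dvd_of_mem_sat hparam.irreducible hl hRsat
    (supported_mono (by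
      rintro ⟨j, k⟩ hk (rfl : j = i)
      exact (show k ≤ ![m₂, m₁] j from hk).trans hmn) hRsupp)
  -- As `A(η) = 0`, the product rule leaves `B(η)` times the partial derivative of `A` at `η`, which
  -- is nonzero. So the variable occurs in `A` and takes up the whole degree of `R`.
  have hfactor : ∀ B, R = A * B → ∀ j, A.degreeOf (j, ![m₂, m₁] j) = 1 ∧
      B.degreeOf (j, ![m₂, m₁] j) = 0 := by
    intro B hB j
    obtain ⟨hdeg, hpd⟩ := hRlin j
    have hR0 : R ≠ 0 := fun h0 => hpd (by rw [h0, map_zero, map_zero])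
    rw [hB] at hR0 hdeg hpd
    rw [Derivation.leibniz, map_add, smul_eq_mul, smul_eq_mul, map_mul, hAeval, zero_mul, zero_add,
      map_mul] at hpd
    have hA1 : 0 < A.degreeOf (j, ![m₂, m₁] j) := by
      rw [DiffAlg.degreeOf_pos_iff]
      by_contra hn
      exact right_ne_zero_of_mul hpd (by rw [pderiv_eq_zero_of_notMem_vars hn, map_zero])
    rw [degreeOf_mul_eq (left_ne_zero_of_mul hR0) (right_ne_zero_of_mul hR0)] at hdeg
    omega
  refine ⟨⟨hparam.irreducible, hdvd, fun B hB => ?_⟩, ?_⟩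
  · have hR0 : R ≠ 0 := fun h0 => (hRlin 0).2 (by rw [h0, map_zero, map_zero])
    rw [hB] at hR0
    have hdegR : ∀ v, R.degreeOf v = A.degreeOf v + B.degreeOf v := fun v => by
      rw [hB, degreeOf_mul_eq (left_ne_zero_of_mul hR0) (right_ne_zero_of_mul hR0)]
    have hle : ∀ j, ((![m₂, m₁] j : ℕ) : WithBot ℕ) ≤ DiffAlg.ord R := fun j => by
      have hmem : (j, ![m₂, m₁] j) ∈ R.vars := by
        rw [← DiffAlg.degreeOf_pos_iff, hdegR, (hfactor B hB j).1]
        omega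
      exact Finset.le_sup (f := fun v : Fin 2 × ℕ => (v.2 : WithBot ℕ)) hmem
    -- Each derivative in `B` also occurs in `R`, so its order is at most the bound for its
    -- indeterminate. Equality is excluded by degree zero, and both bounds are at most `ord R`.
    refine (Finset.sup_lt_iff ((WithBot.bot_lt_coe _).trans_le (hle 0))).2 ?_
    rintro ⟨j, k⟩ hjk
    have hk : k ≤ ![m₂, m₁] j := by
      refine mem_supported.1 hRsupp (show (j, k) ∈ R.vars from ?_)
      rw [← DiffAlg.degreeOf_pos_iff] at hjk ⊢
      rw [hdegR]
      omega
    have hk' : k ≠ ![m₂, m₁] j := by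
      rintro rfl
      rw [← DiffAlg.degreeOf_pos_iff, (hfactor B hB j).2] at hjk
      exact lt_irrefl _ hjk
    exact lt_of_lt_of_le (by exact_mod_cast lt_of_le_of_ne hk hk') (hle j)
  · obtain ⟨B, hB⟩ := hdvd
    exact ⟨(hfactor B hB 0).1, (hfactor B hB 1).1⟩
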